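/- Throughout, $n$ is the security parameter and a QPT (quantum polynomial-time) algorithm is a family of quantum circuits (gates $X$, $H$, $T$, $T^\dagger$, CNOT, Toffoli; ancillas initialised to $|0\rangle$; some wires are output and the others discarded), one circuit for each $n$, whose descriptions are computed from $1^n$ by a classical program in time polynomial in $n$. A function $f:\mathbb N\to\mathbb R$ is negligible if $n^c f(n)\to 0$ for every $c$. Let $\kappa,m:\mathbb N\to\mathbb N$. A *private-key quantum money scheme* consists of QPT algorithms $\mathsf{KeyGen}(1^n)\to k\in\{0,1\}^{\kappa(n)}$, $\mathsf{Mint}(k)\to \$_k$ (an $m(n)$-qubit state) and $\mathsf{Ver}(k,\rho)\to\top/\bot$ such that * (correctness) $1-\Pr[\top\gets\mathsf{Ver}(k,\$_k) : k\gets\mathsf{KeyGen}(1^n)]$ is negligible; * (security) for all polynomials $t,\ell$ and every QPT adversary $\mathcal A$ that maps $t$ banknotes to a (possibly entangled) state on $\ell$ registers of $m$ qubits each, $\Pr[\mathsf{Count}(k,\xi)\ge t+1 : k\gets\mathsf{KeyGen}(1^n),\ \xi\gets\mathcal A(\$_k^{\otimes t})]$ is negligible, where $\mathsf{Count}(k,\xi)$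 runs $\mathsf{Ver}(k,\cdot)$ on each register of $\xi$ and returns the number of outcomes $\top$. The scheme has *pure money states* if $\$_k=|\$_k\rangle\langle\$_k|$ for every key $k$ that $\mathsf{KeyGen}(1^n)$ outputs with positive probability. A *one-way state generator* (OWSG) consists of QPT algorithms $\mathsf{KeyGen}(1^n)\to k\in\{0,1\}^{\kappa(n)}$, $\mathsf{StateGen}(k)\to\phi_k$ (an $m(n)$-qubit state) and $\mathsf{Ver}'(k',\rho)\to\top/\bot$ such that $1-\Pr[\top\gets\mathsf{Ver}'(k,\phi_k): k\gets\mathsf{KeyGen}(1^n)]$ is negligible and, for every polynomial $t$ and every QPT adversary $\mathcal A$, $\Pr[\top\gets\mathsf{Ver}'(k',\phi_k) : k\gets\mathsf{KeyGen}(1^n),\ k'\gets\mathcal A(\phi_k^{\otimes t})]$ is negligible. **Theorem.** If a private-key quantum money scheme with pure money states exists, then an OWSG exists. More precisely, let $(\mathsf{KeyGen},\mathsf{Mint},\mathsf{Ver})$ be a private-key quantum money scheme with pure money states $|\$_k\rangle$. Then there is a QPT algorithm $\mathsf{Ver}'$ such that $(\mathsf{KeyGen},\mathsf{Mint},\mathsf{Ver}')$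 is an OWSG (so its state for the key $k$ is the banknote $|\$_k\rangle$), and $\mathsf{Ver}'$ is the projection onto the banknote of the alleged key: for every $n$, every key $k'$ that $\mathsf{KeyGen}(1^n)$ outputs with positive probability and every $m(n)$-qubit state $\rho$, $\Pr[\top\gets\mathsf{Ver}'(k',\rho)]=\langle\$_{k'}|\rho|\$_{k'}\rangle$. -/

import Mathlib

namespace QCrypto

/-! ### Classical polynomial time

Programs act on binary trees (the data of the WHILE language).  Every elementary operation is
charged the size of the data it acts on, so that up to a polynomial the cost of a run is the
running time of a Turing machine.  These programs are used to write down quantum circuits. -/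

/-- Binary trees: the data that classical programs work on. -/
inductive Data : Type
  | nil : Data
  | cons : Data → Data → Data

namespace Data

/-- The number of nodes of a tree. -/
def size : Data → ℕ
  | nil => 1
  | cons a b => a.size + b.size + 1

/-- Head (left subtree), with `head nil = nil`. -/
def head : Data → Data
  | nil => nil
  | cons a _ => a

/-- Tail (right subtree), with `tail nil = nil`. -/
def tail : Data → Data
  | nil => nil
  | cons _ b => b

/-- A finite list as a tree. -/
def ofList : List Data → Data
  | [] => nil
  | d :: l => cons d (ofList l)

/-- The natural number `n` in unary, that is, the string `1ⁿ`. -/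
def ofNat (n : ℕ) : Data := ofList (List.replicate n nil)

end Data

/-- Classical programs. -/
inductive Prog : Type
  /-- return the input -/
  | id : Prog
  /-- return `nil` -/
  | nil : Prog
  /-- return the left subtree of the input -/
  | head : Prog
  /-- return the right subtree of the input -/
  | tail : Prog
  /-- run both programs on the input and return the pair of their results -/
  | cons : Prog → Prog → Prog
  /-- `comp q p` runs `p` on the input and then `q` on the result -/
  | comp : Prog → Prog → Prog
  /-- `ite c p q` runs `c` on the input; then it runs `q` on the input if the result is `nil`,
  and `p` on the input otherwise -/
  | ite : Prog → Prog → Prog → Prog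
  /-- `loop p` applies `p` repeatedly, as long as the left subtree is not `nil` -/
  | loop : Prog → Prog

/-- `Runs P x y t`: the program `P` halts on the input `x` with output `y`, at cost `t`. -/
inductive Runs : Prog → Data → Data → ℕ → Prop
  | id (x : Data) : Runs .id x x (1 + x.size)
  | nil (x : Data) : Runs .nil x .nil (1 + x.size)
  | head (x : Data) : Runs .head x x.head (1 + x.size)
  | tail (x : Data) : Runs .tail x x.tail (1 + x.size)
  | cons {p q : Prog} {x y z : Data} {s t : ℕ} (hp : Runs p x y s) (hq : Runs q x z t) :
      Runs (.cons p q) x (.cons y z) (1 + x.size + s + t)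
  | comp {p q : Prog} {x y z : Data} {s t : ℕ} (hp : Runs p x y s) (hq : Runs q y z t) :
      Runs (.comp q p) x z (1 + x.size + s + t)
  | ite_true {c p q : Prog} {x a b y : Data} {s t : ℕ} (hc : Runs c x (.cons a b) s)
      (hp : Runs p x y t) : Runs (.ite c p q) x y (1 + x.size + s + t)
  | ite_false {c p q : Prog} {x y : Data} {s t : ℕ} (hc : Runs c x .nil s)
      (hq : Runs q x y t) : Runs (.ite c p q) x y (1 + x.size + s + t)
  | loop_stop {p : Prog} {x : Data} (hx : x.head = .nil) : Runs (.loop p) x x (1 + x.size)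
  | loop_step {p : Prog} {x y z : Data} {s t : ℕ} (hx : x.head ≠ .nil) (hp : Runs p x y s)
      (hl : Runs (.loop p) y z t) : Runs (.loop p) x z (1 + x.size + s + t)

/-- The sequence `f` can be written down in polynomial time: one program computes `f n` from `1ⁿ`
for every `n`, at a cost that is at most a polynomial in `n`. -/
def PolyTimeGenerated (f : ℕ → Data) : Prop :=
  ∃ (P : Prog) (p : Polynomial ℕ), ∀ n, ∃ t ≤ p.eval n, Runs P (Data.ofNat n) (f n) t

/-! ### Quantum circuits -/

/-- Gates on wires labelled by `W`: Pauli X, Hadamard, the `π/8` gate `T` and its inverse, CNOT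
(control, target) and Toffoli (control, control, target). -/
inductive Gate (W : Type) : Type
  | x (a : W) : Gate W
  | h (a : W) : Gate W
  | t (a : W) : Gate W
  | tdg (a : W) : Gate W
  | cnot (a b : W) (hab : a ≠ b) : Gate W
  | ccx (a b c : W) (hab : a ≠ b) (hac : a ≠ c) (hbc : b ≠ c) : Gate W

/-- The matrix of a gate in the computational basis of `(ℂ²)^{⊗ W}`. -/
noncomputable def Gate.matrix {W : Type} [Fintype W] [DecidableEq W] :
    Gate W → Matrix (W → Bool) (W → Bool) ℂ
  | .x a => .of fun y z => if y = Function.update z a (!z a) then 1 else 0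
  | .h a => .of fun y z =>
      if ∀ w, w ≠ a → y w = z w then (if y a && z a then -1 else 1) / (Real.sqrt 2 : ℂ) else 0
  | .t a => .diagonal fun z => if z a then Complex.exp (Real.pi / 4 * Complex.I) else 1
  | .tdg a => .diagonal fun z => if z a then Complex.exp (-(Real.pi / 4 * Complex.I)) else 1
  | .cnot a b _ => .of fun y z => if y = Function.update z b (xor (z b) (z a)) then 1 else 0
  | .ccx a b c _ _ _ => .of fun y z =>
      if y = Function.update z c (xor (z c) (z a && z b)) then 1 else 0

/-- The unitary of a list of gates; the first gate of the list is applied first. -/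
noncomputable def gatesMatrix {W : Type} [Fintype W] [DecidableEq W] (l : List (Gate W)) :
    Matrix (W → Bool) (W → Bool) ℂ :=
  l.foldl (fun M g => g.matrix * M) 1

/-- Basis strings of an `n`-qubit register. -/
abbrev Bits (n : ℕ) : Type := Fin n → Bool

/-- Operators on an `n`-qubit register; the (mixed) states are among them. -/
abbrev Op (n : ℕ) : Type := Matrix (Bits n) (Bits n) ℂ

/-- The state `|x⟩⟨x|` of a classical string `x`. -/
def ket {n : ℕ} (x : Bits n) : Op n := Matrix.single x x 1

/-- The product state `ρ ⊗ σ`. -/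
def tensor {a b : ℕ} (ρ : Op a) (σ : Op b) : Op (a + b) :=
  .of fun x y =>
    ρ (fun i => x (Fin.castAdd b i)) (fun i => y (Fin.castAdd b i)) *
      σ (fun i => x (Fin.natAdd a i)) (fun i => y (Fin.natAdd a i))

/-- The `j`-th block of `m` bits of a string of `t * m` bits. -/
def block {t m : ℕ} (x : Bits (t * m)) (j : Fin t) : Bits m := fun i => x (finProdFinEquiv (j, i))

/-- `t` copies of a state, `ρ^{⊗ t}`. -/
def copies (t : ℕ) {m : ℕ} (ρ : Op m) : Op (t * m) :=
  .of fun x y => ∏ j : Fin t, ρ (block x j) (block y j)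

/-- A quantum circuit with `a` input and `b` output qubits.  The wires are the `a` input wires
followed by `anc` ancilla wires, which start in the state `|0⟩`.  After the gates, the wires
`out 0, …, out (b - 1)` are the output and the other wires are discarded. -/
structure QCircuit (a b : ℕ) where
  anc : ℕ
  gates : List (Gate (Fin (a + anc)))
  out : Fin b ↪ Fin (a + anc)

/-- The partial trace onto the wires `out 0, …, out (b - 1)`. -/
def reduceTo {b n : ℕ} (out : Fin b ↪ Fin n) (M : Op n) : Op b :=
  .of fun y y' => ∑ x : Bits n, ∑ x' : Bits n,
    if (∀ i, x (out i) = y i) ∧ (∀ i, x' (out i) = y' i) ∧ ∀ w ∉ Set.range out, x w = x' w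
    then M x x' else 0

/-- The quantum channel of a circuit. -/
noncomputable def QCircuit.run {a b : ℕ} (C : QCircuit a b) (ρ : Op a) : Op b :=
  reduceTo C.out
    (gatesMatrix C.gates * tensor ρ (ket fun _ : Fin C.anc => false) *
      (gatesMatrix C.gates).conjTranspose)

/-- The probability of the outcome `y`, when the output of the circuit on the state `ρ` is measured
in the computational basis. -/
noncomputable def QCircuit.prob {a b : ℕ} (C : QCircuit a b) (ρ : Op a) (y : Bits b) : ℝ :=
  (C.run ρ y y).re

/-- The description of a gate: its kind and its wires, in unary. -/
def Gate.encode {n : ℕ} : Gate (Fin n) → Data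
  | .x a => .ofList [.ofNat 0, .ofNat a]
  | .h a => .ofList [.ofNat 1, .ofNat a]
  | .t a => .ofList [.ofNat 2, .ofNat a]
  | .tdg a => .ofList [.ofNat 3, .ofNat a]
  | .cnot a b _ => .ofList [.ofNat 4, .ofNat a, .ofNat b]
  | .ccx a b c _ _ _ => .ofList [.ofNat 5, .ofNat a, .ofNat b, .ofNat c]

/-- The description of a circuit: the numbers of input and of ancilla wires, the list of the gates
and the list of the output wires. -/
def QCircuit.encode {a b : ℕ} (C : QCircuit a b) : Data :=
  .ofList [.ofNat a, .ofNat C.anc, .ofList (C.gates.map Gate.encode),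
    .ofList (List.ofFn fun i => .ofNat (C.out i))]

/-- A quantum algorithm with `a n` input and `b n` output qubits at security parameter `n`: one
circuit for each security parameter. -/
abbrev QAlgorithm (a b : ℕ → ℕ) : Type := ∀ n : ℕ, QCircuit (a n) (b n)

/-- Quantum polynomial time (QPT): the circuits are written down by a classical program from `1ⁿ`
in time polynomial in `n`. -/
def IsQPT {a b : ℕ → ℕ} (A : QAlgorithm a b) : Prop :=
  PolyTimeGenerated fun n => (A n).encode

/-! ### One-way state generators and private-key quantum money -/

/-- Negligible functions of the security parameter: `n ^ c * f n → 0` for every `c`. -/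
def Negligible (f : ℕ → ℝ) : Prop :=
  Asymptotics.SuperpolynomialDecay Filter.atTop (fun n : ℕ => (n : ℝ)) f

section Algorithms

variable {κ m : ℕ → ℕ}

/-- The probability that `KeyGen(1ⁿ)` outputs the key `k`. -/
noncomputable def keyProb (KeyGen : QAlgorithm (fun _ => 0) κ) (n : ℕ) (k : Bits (κ n)) : ℝ :=
  (KeyGen n).prob (ket fun _ : Fin 0 => false) k

/-- The state that `StateGen` (or `Mint`) outputs on the key `k`. -/
noncomputable def stateOf (StateGen : QAlgorithm κ m) (n : ℕ) (k : Bits (κ n)) : Op (m n) :=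
  (StateGen n).run (ket k)

/-- The probability that `Ver` outputs `⊤` on the key `k` and the state `ρ`; the output of `Ver` is
one bit, and `true` stands for `⊤`. -/
noncomputable def acceptProb (Ver : QAlgorithm (fun n => κ n + m n) (fun _ => 1)) (n : ℕ)
    (k : Bits (κ n)) (ρ : Op (m n)) : ℝ :=
  (Ver n).prob (tensor (ket k) ρ) fun _ => true

/-- `(KeyGen, StateGen, Ver)` is a one-way state generator, with keys of `κ n` bits and states of
`m n` qubits. -/
structure IsOWSG (KeyGen : QAlgorithm (fun _ => 0) κ) (StateGen : QAlgorithm κ m)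
    (Ver : QAlgorithm (fun n => κ n + m n) (fun _ => 1)) : Prop where
  keyGen_qpt : IsQPT KeyGen
  stateGen_qpt : IsQPT StateGen
  ver_qpt : IsQPT Ver
  correct : Negligible fun n =>
    1 - ∑ k, keyProb KeyGen n k * acceptProb Ver n k (stateOf StateGen n k)
  /-- An adversary that gets `t` copies of the state finds an accepted key with at most negligible
  probability. -/
  secure : ∀ (t : Polynomial ℕ) (A : QAlgorithm (fun n => t.eval n * m n) κ), IsQPT A →
    Negligible fun n => ∑ k, keyProb KeyGen n k *
      ∑ k', (A n).prob (copies (t.eval n) (stateOf StateGen n k)) k' *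
        acceptProb Ver n k' (stateOf StateGen n k)

/-- The probability that exactly the registers `j` with `v j = true` are accepted, when `Ver(k, ·)`
is run on each of the `l` registers of the (possibly entangled) state `ξ`.  The channel
`Φ = Ver(k, ·)` acts as `Φ^{⊗ l}`: on `ξ = ∑ ξ x y • ⨂ⱼ |xⱼ⟩⟨yⱼ|` it acts factor by factor. -/
noncomputable def verdictProb (Ver : QAlgorithm (fun n => κ n + m n) (fun _ => 1)) (n : ℕ)
    (k : Bits (κ n)) {l : ℕ} (ξ : Op (l * m n)) (v : Fin l → Bool) : ℝ :=
  (∑ x, ∑ y, ξ x y *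
    ∏ j, (Ver n).run (tensor (ket k) (Matrix.single (block x j) (block y j) 1))
      (fun _ => v j) (fun _ => v j)).re

/-- The probability that at least `s` of the `l` registers of `ξ` are accepted by `Ver(k, ·)`,
`Pr[Count(k, ξ) ≥ s]`. -/
noncomputable def countProb (Ver : QAlgorithm (fun n => κ n + m n) (fun _ => 1)) (n : ℕ)
    (k : Bits (κ n)) {l : ℕ} (ξ : Op (l * m n)) (s : ℕ) : ℝ :=
  ∑ v : Fin l → Bool with s ≤ (Finset.univ.filter fun j => v j = true).card,
    verdictProb Ver n k ξ v

/-- `(KeyGen, Mint, Ver)` is a private-key quantum money scheme, with keys of `κ n` bits and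
banknotes of `m n` qubits. -/
structure IsPrivateKeyQuantumMoney (KeyGen : QAlgorithm (fun _ => 0) κ) (Mint : QAlgorithm κ m)
    (Ver : QAlgorithm (fun n => κ n + m n) (fun _ => 1)) : Prop where
  keyGen_qpt : IsQPT KeyGen
  mint_qpt : IsQPT Mint
  ver_qpt : IsQPT Ver
  correct : Negligible fun n =>
    1 - ∑ k, keyProb KeyGen n k * acceptProb Ver n k (stateOf Mint n k)
  /-- A counterfeiter that gets `t` banknotes and outputs polynomially many registers makes more
  than `t` of them pass with at most negligible probability. -/
  secure : ∀ (t l : Polynomial ℕ)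
      (A : QAlgorithm (fun n => t.eval n * m n) (fun n => l.eval n * m n)), IsQPT A →
    Negligible fun n => ∑ k, keyProb KeyGen n k *
      countProb Ver n k ((A n).run (copies (t.eval n) (stateOf Mint n k))) (t.eval n + 1)

/-- The money states are pure: on every key `k` that `KeyGen` can output, `Mint` outputs
`|$ₖ⟩⟨$ₖ|`, where `|$ₖ⟩ = money n k`. -/
def HasPureMoney (KeyGen : QAlgorithm (fun _ => 0) κ) (Mint : QAlgorithm κ m)
    (money : ∀ n, Bits (κ n) → Bits (m n) → ℂ) : Prop :=
  ∀ n k, 0 < keyProb KeyGen n k →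
    stateOf Mint n k = Matrix.vecMulVec (money n k) (star (money n k))

end Algorithms

end QCrypto

set_option linter.unusedSectionVars false

namespace QCrypto

/-! ### Typed polynomial-time functions -/

namespace Data

/-! The verifier is `projCircuit`: it copies the key to a fresh register, runs `Mint` there, swaps
the minted output with the submitted state ρ, undoes `Mint` and accepts if the register holds the
key again. Let σ be the state minted from the key, with the other wires traced out. The operator of
the accepting branch is σ itself (`projPrep_key`), so the acceptance probability is tr(σρσ†)
(`prob_projCircuit`). If σ = |u⟩⟨u| is pure, this equals ⟨u|ρ|u⟩, whatever `Mint` leaves on its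
discarded wires; in particular a banknote is accepted under its own key with certainty.

For security, let an adversary find k' from t banknotes |u⟩ of the key k, and let σ' be the state
minted from k'. Since k' need not be a possible output of `KeyGen`, σ' may be mixed; still k' is
accepted with probability ⟨u|σ'²|u⟩ ≤ ⟨u|σ'|u⟩ (`sub_sq_posSemidef`). Let E be the effect of Ver(k,
·) and δ = 1 - ⟨u|E|u⟩. Cauchy-Schwarz gives |u⟩⟨u| ≤ 2E + 2δ (`overlap_le`), so the overlap is at
most 2w + 2δ, where w = tr(Eσ') is the probability that one copy of σ' passes as a banknote of k.

The forger `cloneCircuit` runs the adversary and mints l copies from the key found. Given k', the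
verdicts on the copies are independent (`run_cloneCircuit`, `countProb_sum`). If lw ≥ 2t + 2, at
least t + 1 of them pass with probability at least 1/2 (`half_le_tail`); hence always w ≤ (2t + 2)/l
+ 2 Pr[at least t + 1 pass]. On average over the keys, the advantage is at most 4(t + 1)/l plus four
times the forging probability plus twice the correctness error (`owsg_advantage_le`). Negligibility
is tested for one exponent c at a time, so the forger may depend on c: l = (t + 1)n^(c+1) is large
enough.

Both circuits must also be uniform. Their descriptions are explicit functions of the descriptions of
`Mint` and of the adversary (`raw_projCircuit`, `raw_cloneCircuit`), and these functions are built
from operations under which `PolyTime` is closed. -/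

@[simp] lemma size_nil : nil.size = 1 := rfl
@[simp] lemma size_cons (a b : Data) : (cons a b).size = a.size + b.size + 1 := rfl

lemma one_le_size (d : Data) : 1 ≤ d.size := by cases d <;> simp

end Data

/-- Every operation is charged the size of its data, so a time bound also bounds the size of the
result; compositions need this. -/
lemma Runs.size_le {P : Prog} {x y : Data} {t : ℕ} (h : Runs P x y t) : y.size ≤ t := by
  induction h with
  | id x => omega
  | nil x => simp
  | head x => cases x <;> simp [Data.head]; omega
  | tail x => cases x <;> simp [Data.tail]; omega
  | cons _ _ h₁ h₂ => simp; omega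
  | comp _ _ _ _ => omega
  | ite_true _ _ _ _ => omega
  | ite_false _ _ _ _ => omega
  | loop_stop _ => omega
  | loop_step _ _ _ _ _ => omega

/-- Types whose elements are represented by trees. -/
class Enc (α : Type) where
  enc : α → Data

open Enc

instance : Enc Unit := ⟨fun _ => .nil⟩
instance {α β : Type} [Enc α] [Enc β] : Enc (α × β) := ⟨fun x => .cons (enc x.1) (enc x.2)⟩
instance {α : Type} [Enc α] : Enc (List α) := ⟨fun l => .ofList (l.map enc)⟩
instance : Enc ℕ := ⟨Data.ofNat⟩

section
variable {α β γ δ σ : Type} [Enc α] [Enc β] [Enc γ] [Enc δ] [Enc σ]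

lemma enc_pair (a : α) (b : β) : enc (a, b) = .cons (enc a) (enc b) := rfl
lemma enc_nil : enc ([] : List α) = .nil := rfl
lemma enc_cons (a : α) (l : List α) : enc (a :: l) = .cons (enc a) (enc l) := rfl
lemma enc_succ (n : ℕ) : enc (n + 1) = .cons .nil (enc n) := rfl

/-- A function that a program computes in polynomial time on the representing trees. -/
def PolyTime (f : α → β) : Prop :=
  ∃ (P : Prog) (p : Polynomial ℕ), ∀ a, ∃ t ≤ p.eval (enc a).size, Runs P (enc a) (enc (f a)) t

lemma eval_mono (p : Polynomial ℕ) {a b : ℕ} (h : a ≤ b) : p.eval a ≤ p.eval b := by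
  induction p using Polynomial.induction_on' with
  | add p q hp hq => simpa using Nat.add_le_add hp hq
  | monomial n c => simpa using Nat.mul_le_mul_left c (Nat.pow_le_pow_left h n)

/-! ### Closure properties of polynomial-time functions -/

namespace PolyTime

lemma size_le {f : α → β} (hf : PolyTime f) :
    ∃ p : Polynomial ℕ, ∀ a, (enc (f a)).size ≤ p.eval (enc a).size := by
  obtain ⟨P, p, h⟩ := hf
  refine ⟨p, fun a => ?_⟩
  obtain ⟨t, ht, hr⟩ := h a
  exact hr.size_le.trans ht

/-- Functions with the same effect on the representing trees. -/
lemma of_enc {f : α → β} {g : γ → δ} (hg : PolyTime g) (i : α → γ) (hi : ∀ a, enc (i a) = enc a)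
    (hfg : ∀ a, enc (f a) = enc (g (i a))) : PolyTime f := by
  obtain ⟨P, p, h⟩ := hg
  refine ⟨P, p, fun a => ?_⟩
  simpa only [hi, hfg] using h (i a)

lemma id : PolyTime (fun a : α => a) :=
  ⟨.id, 1 + .X, fun a => ⟨_, by simp, .id _⟩⟩

lemma comp {g : β → γ} {f : α → β} (hg : PolyTime g) (hf : PolyTime f) :
    PolyTime (fun a => g (f a)) := by
  obtain ⟨Q, q, hq⟩ := hg
  obtain ⟨P, p, hp⟩ := hf
  refine ⟨.comp Q P, 1 + .X + p + q.comp p, fun a => ?_⟩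
  obtain ⟨s, hs, hs'⟩ := hp a
  obtain ⟨t, ht, ht'⟩ := hq (f a)
  refine ⟨_, ?_, .comp hs' ht'⟩
  have := eval_mono q (hs'.size_le.trans hs)
  simp only [Polynomial.eval_add, Polynomial.eval_one, Polynomial.eval_X, Polynomial.eval_comp]
  omega

lemma pair {f : α → β} {g : α → γ} (hf : PolyTime f) (hg : PolyTime g) :
    PolyTime (fun a => (f a, g a)) := by
  obtain ⟨P, p, hp⟩ := hf
  obtain ⟨Q, q, hq⟩ := hg
  refine ⟨.cons P Q, 1 + .X + p + q, fun a => ?_⟩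
  obtain ⟨s, hs, hs'⟩ := hp a
  obtain ⟨t, ht, ht'⟩ := hq a
  refine ⟨_, ?_, .cons hs' ht'⟩
  simp only [Polynomial.eval_add, Polynomial.eval_one, Polynomial.eval_X]
  omega

lemma fst' : PolyTime (fun x : α × β => x.1) :=
  ⟨.head, 1 + .X, fun a => ⟨_, by simp, .head (enc a)⟩⟩

lemma snd' : PolyTime (fun x : α × β => x.2) :=
  ⟨.tail, 1 + .X, fun a => ⟨_, by simp, .tail (enc a)⟩⟩

lemma fst {f : α → β × γ} (hf : PolyTime f) : PolyTime (fun a => (f a).1) := fst'.comp hf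

lemma snd {f : α → β × γ} (hf : PolyTime f) : PolyTime (fun a => (f a).2) := snd'.comp hf

lemma constNil {b : β} (hb : enc b = .nil) : PolyTime (fun _ : α => b) :=
  ⟨.nil, 1 + .X, fun a => ⟨1 + (enc a).size, by simp, hb.symm ▸ Runs.nil (enc a)⟩⟩

lemma zero : PolyTime (fun _ : α => 0) := constNil rfl

lemma unit : PolyTime (fun _ : α => ()) := constNil rfl

lemma nil : PolyTime (fun _ : α => ([] : List β)) := constNil rfl

lemma cons {f : α → β} {g : α → List β} (hf : PolyTime f) (hg : PolyTime g) :
    PolyTime (fun a => f a :: g a) :=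
  (hf.pair hg).of_enc (fun a => a) (fun _ => rfl) fun _ => rfl

lemma succ {f : α → ℕ} (hf : PolyTime f) : PolyTime (fun a => f a + 1) :=
  ((unit (α := α)).pair hf).of_enc (fun a => a) (fun _ => rfl) fun _ => rfl

lemma natConst (n : ℕ) : PolyTime (fun _ : α => n) := by
  induction n with
  | zero => exact zero
  | succ n ih => exact ih.succ

lemma tail {f : α → List β} (hf : PolyTime f) : PolyTime (fun a => (f a).tail) :=
  comp (g := fun l : List β => l.tail)
    ⟨.tail, 1 + .X, fun a => ⟨1 + (enc a).size, by simp, by cases a <;> exact .tail (enc _)⟩⟩ hf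

/-- The default has to be 0: the head of `nil` is `nil`, which encodes 0. -/
lemma headD {f : α → List ℕ} (hf : PolyTime f) : PolyTime (fun a => (f a).headD 0) :=
  comp (g := fun l : List ℕ => l.headD 0)
    ⟨.head, 1 + .X, fun a => ⟨1 + (enc a).size, by simp, by cases a <;> exact .head (enc _)⟩⟩ hf

/-- The loop acts on the pair of the remaining list and the accumulator. A nonempty list is never
encoded by `nil`, so the loop stops exactly at the end of the list. The bound `B` on the
accumulators of all prefixes controls the cost of each pass. -/
lemma foldl_aux {step : σ × α → σ} {S : Prog} {p : Polynomial ℕ}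
    (hS : ∀ x, ∃ t ≤ p.eval (enc x).size, Runs S (enc x) (enc (step x)) t) (B : ℕ) (l : List α)
    (s : σ) (hB : ∀ k ≤ l.length, (enc ((l.take k).foldl (fun s a => step (s, a)) s)).size ≤ B) :
    ∃ t ≤ l.length * (30 + 12 * ((enc l).size + B) + p.eval ((enc l).size + B)) +
        (2 + (enc l).size + B),
      Runs (.loop (.cons (.comp .tail .head) (.comp S (.cons .tail (.comp .head .head)))))
        (.cons (enc l) (enc s)) (.cons .nil (enc (l.foldl (fun s a => step (s, a)) s))) t := by
  induction l generalizing s with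
  | nil =>
    refine ⟨_, ?_, Runs.loop_stop rfl⟩
    have := hB 0 le_rfl
    simp [enc_nil] at this ⊢
    omega
  | cons a l ih =>
    obtain ⟨t, ht, hr⟩ := ih (step (s, a)) fun k hk => by
      simpa using hB (k + 1) (by simpa using hk)
    obtain ⟨u, hu, hu'⟩ := hS (s, a)
    refine ⟨_, ?_, .loop_step (by simp [enc_cons, Data.head]) (.cons (.comp (.head _) (.tail _))
      (.comp (.cons (.tail _) (.comp (.head _) (.head _))) hu')) hr⟩
    have h0 : (enc s).size ≤ B := by simpa using hB 0 (by simp)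
    have h1 := eval_mono p (a := (enc (s, a)).size) (b := (enc (a :: l)).size + B) (by
      have := (enc l).one_le_size
      simp [enc_pair, enc_cons]; omega)
    have h2 := eval_mono p (a := (enc l).size + B) (b := (enc (a :: l)).size + B)
      (by simp [enc_cons]; omega)
    have h3 : l.length * (30 + 12 * ((enc l).size + B) + p.eval ((enc l).size + B)) ≤
        l.length * (30 + 12 * ((enc (a :: l)).size + B) + p.eval ((enc (a :: l)).size + B)) := by
      gcongr
      simp [enc_cons]; omega
    rw [List.length_cons, Nat.add_mul, Nat.one_mul]
    generalize l.length * (30 + 12 * ((enc (a :: l)).size + B) + p.eval ((enc (a :: l)).size + B))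
      = z at *
    simp only [enc_cons, Data.head, Data.size_cons] at *
    omega

lemma length_le_size (l : List α) : l.length ≤ (enc l).size := by
  induction l with
  | nil => simp
  | cons a l ih => simp [enc_cons]; omega

lemma size_take_le (l : List α) (k : ℕ) : (enc (l.take k)).size ≤ (enc l).size := by
  induction l generalizing k with
  | nil => simp
  | cons a l ih =>
    cases k with
    | zero => simpa [enc_nil] using Data.one_le_size _
    | succ k => simpa [enc_cons] using ih k

/-- A fold whose accumulator stays of polynomial size. -/
lemma foldl' {step : σ × α → σ} (hs : PolyTime step) (q : Polynomial ℕ)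
    (hq : ∀ (l : List α) (s : σ), (enc (l.foldl (fun s a => step (s, a)) s)).size ≤
      q.eval ((enc l).size + (enc s).size)) :
    PolyTime (fun x : List α × σ => x.1.foldl (fun s a => step (s, a)) x.2) := by
  obtain ⟨S, p, hS⟩ := hs
  refine ⟨.comp .tail (.loop (.cons (.comp .tail .head)
    (.comp S (.cons .tail (.comp .head .head))))),
    -- The summands cover the passes of the loop, its exit test, the extraction of the accumulator
    -- and the outer composition, with some slack.
    .X * (30 + 12 * (.X + q) + p.comp (.X + q)) + (2 + .X + q) + (3 + .X + q) + (1 + .X),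
    fun ⟨l, s⟩ => ?_⟩
  obtain ⟨t, ht, hr⟩ := foldl_aux hS (q.eval ((enc l).size + (enc s).size)) l s fun k _ =>
    (hq _ _).trans (eval_mono q (by have := size_take_le l k; omega))
  refine ⟨_, ?_, .comp hr (.tail _)⟩
  have h1 := hq l s
  have h2 := eval_mono q (a := (enc l).size + (enc s).size) (b := (enc (l, s)).size)
    (by simp [enc_pair])
  have h3 : (enc l).size ≤ (enc (l, s)).size := by simp [enc_pair]; omega
  have h4 := eval_mono p (Nat.add_le_add h3 h2)
  have h5 : l.length * (30 + 12 * ((enc l).size + q.eval ((enc l).size + (enc s).size)) +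
      p.eval ((enc l).size + q.eval ((enc l).size + (enc s).size))) ≤
      (enc (l, s)).size * (30 + 12 * ((enc (l, s)).size + q.eval (enc (l, s)).size) +
      p.eval ((enc (l, s)).size + q.eval (enc (l, s)).size)) :=
    Nat.mul_le_mul ((length_le_size l).trans h3) (by omega)
  simp only [Polynomial.eval_add, Polynomial.eval_mul, Polynomial.eval_comp, Polynomial.eval_X,
    Polynomial.eval_one, Polynomial.eval_ofNat, ← enc_pair] at *
  simp only [Data.size_cons, Data.size_nil]
  omega

lemma foldl {f : α → List β} {g : α → σ} {step : σ × β → σ} (hf : PolyTime f) (hg : PolyTime g)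
    (hs : PolyTime step) (q : Polynomial ℕ)
    (hq : ∀ (l : List β) (s : σ), (enc (l.foldl (fun s a => step (s, a)) s)).size ≤
      q.eval ((enc l).size + (enc s).size)) :
    PolyTime (fun a => (f a).foldl (fun s b => step (s, b)) (g a)) :=
  (foldl' hs q hq).comp (hf.pair hg)

lemma reverseAux {f g : α → List β} (hf : PolyTime f) (hg : PolyTime g) :
    PolyTime (fun a => (f a).reverseAux (g a)) := by
  have h := foldl (step := fun x : List β × β => x.2 :: x.1) hf hg
    (snd'.cons fst') .X (fun l s => by
      induction l generalizing s with
      | nil => simp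
      | cons b l ih =>
        refine (ih _).trans ?_
        simp [enc_cons]; omega)
  convert h using 2 with a
  generalize g a = s
  induction f a generalizing s with
  | nil => rfl
  | cons b l ih => exact ih _

lemma reverse {f : α → List β} (hf : PolyTime f) : PolyTime (fun a => (f a).reverse) :=
  hf.reverseAux nil

lemma append {f g : α → List β} (hf : PolyTime f) (hg : PolyTime g) :
    PolyTime (fun a => f a ++ g a) := by
  convert hf.reverse.reverseAux hg using 2
  simp [List.reverseAux_eq]

lemma size_append (l l' : List α) : (enc (l ++ l')).size + 1 = (enc l).size + (enc l').size := by
  induction l with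
  | nil => simp [enc_nil]; omega
  | cons a l ih => simp [enc_cons]; omega

lemma flatten {f : α → List (List β)} (hf : PolyTime f) : PolyTime (fun a => (f a).flatten) := by
  have h := foldl (step := fun x : List β × List β => x.1 ++ x.2) hf nil
    (fst'.append snd') .X (fun l s => by
      induction l generalizing s with
      | nil => simp
      | cons b l ih =>
        refine (ih _).trans ?_
        have := size_append s b
        simp [enc_cons]; omega)
  convert h using 2 with a
  have (l : List (List β)) (s : List β) : l.foldl (fun s b => s ++ b) s = s ++ l.flatten := by
    induction l generalizing s with
    | nil => simp
    | cons b l ih => simp [ih]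
  simp [this]

/-- The parameter `c` travels unchanged in the accumulator, so that the mapped function may depend
on the input; each element adds one value of `g` and one node. -/
lemma map_aux {g : γ × β → δ} (q : Polynomial ℕ)
    (hq : ∀ x, (enc (g x)).size ≤ q.eval (enc x).size) (l : List β) (c : γ) (s : List δ) :
    (enc (l.foldl (fun s b => (s.1, g (s.1, b) :: s.2)) (c, s))).size ≤
      (enc (c, s)).size + l.length * (1 + q.eval ((enc l).size + (enc c).size)) := by
  induction l generalizing s with
  | nil => simp
  | cons b l ih =>
    refine (ih _).trans ?_
    have h1 := (hq (c, b)).trans (eval_mono q (b := (enc (b :: l)).size + (enc c).size) (by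
      have := (enc l).one_le_size
      simp [enc_cons, enc_pair]; omega))
    have h2 := eval_mono q (a := (enc l).size + (enc c).size)
      (b := (enc (b :: l)).size + (enc c).size) (by simp [enc_cons]; omega)
    have h3 : l.length * (1 + q.eval ((enc l).size + (enc c).size)) ≤
      l.length * (1 + q.eval ((enc (b :: l)).size + (enc c).size)) := by gcongr
    rw [List.length_cons, Nat.add_mul, Nat.one_mul]
    simp only [enc_pair, enc_cons, Data.size_cons] at *
    omega

lemma map {f : α → List β} {g : α → β → δ} (hf : PolyTime f)
    (hg : PolyTime (fun x : α × β => g x.1 x.2)) : PolyTime (fun a => (f a).map (g a)) := by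
  obtain ⟨q, hq⟩ := hg.size_le
  have h := foldl (step := fun x : (α × List δ) × β => (x.1.1, g x.1.1 x.2 :: x.1.2)) hf
    (id.pair nil)
    (fst'.fst.pair ((hg.comp (fst'.fst.pair snd')).cons fst'.snd))
    (.X + .X * (1 + q)) (fun l s => by
      obtain ⟨c, s⟩ := s
      refine (map_aux (g := fun x : α × β => g x.1 x.2) q hq l c s).trans ?_
      simp only [Polynomial.eval_add, Polynomial.eval_mul, Polynomial.eval_X, Polynomial.eval_one]
      have := length_le_size l
      gcongr
      · omega
      · omega
      · exact eval_mono q (by simp [enc_pair]; omega))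
  have h' := h.snd.reverse
  convert h' using 2 with a
  have (l : List β) (s : List δ) :
      (l.foldl (fun (s : α × List δ) b => (s.1, g s.1 b :: s.2)) (a, s)).2.reverse =
        s.reverse ++ l.map (g a) := by
    induction l generalizing s with
    | nil => simp
    | cons b l ih => simp [ih]
  simp [this]

lemma flatMap {f : α → List β} {g : α → β → List δ} (hf : PolyTime f)
    (hg : PolyTime (fun x : α × β => g x.1 x.2)) : PolyTime (fun a => (f a).flatMap (g a)) :=
  (hf.map hg).flatten

/-- A unary number is the same tree as a list of units, so arithmetic and counted loops reduce to
operations on lists. -/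
lemma enc_replicate (n : ℕ) : enc (List.replicate n ()) = enc n := by
  induction n with
  | zero => rfl
  | succ n ih => rw [List.replicate_succ, enc_cons, ih]; rfl

lemma units {f : α → ℕ} (hf : PolyTime f) : PolyTime (fun a => List.replicate (f a) ()) :=
  hf.of_enc (fun a => a) (fun _ => rfl) fun _ => enc_replicate _

lemma length {f : α → List β} (hf : PolyTime f) : PolyTime (fun a => (f a).length) :=
  (hf.map (unit (α := α × β))).of_enc (fun a => a) (fun _ => rfl) fun a => by
    rw [← enc_replicate, ← List.map_const']

lemma add {f g : α → ℕ} (hf : PolyTime f) (hg : PolyTime g) : PolyTime (fun a => f a + g a) := by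
  convert (hf.units.append hg.units).length using 2
  simp

lemma mul {f g : α → ℕ} (hf : PolyTime f) (hg : PolyTime g) : PolyTime (fun a => f a * g a) := by
  convert (hf.units.flatMap (g := fun a _ => List.replicate (g a) ())
    (hg.comp fst').units).length using 2
  simp

lemma size_nat (n : ℕ) : (enc n).size = 2 * n + 1 := by
  induction n with
  | zero => rfl
  | succ n ih => simp [enc_succ, ih]; omega

lemma range {f : α → ℕ} (hf : PolyTime f) : PolyTime (fun a => List.range (f a)) := by
  have hfold (l : List Unit) (s : ℕ × List ℕ) :
      l.foldl (fun (s : ℕ × List ℕ) _ => (s.1 + 1, s.1 :: s.2)) s =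
        (s.1 + l.length, ((List.range l.length).map (s.1 + ·)).reverse ++ s.2) := by
    induction l generalizing s with
    | nil => simp
    | cons b l ih =>
      rw [List.foldl_cons, ih, List.length_cons, List.range_succ_eq_map]
      simp [Function.comp_def, add_comm, add_left_comm]
  -- The entries are written in unary, so the size of the list is quadratic.
  have hsize (k s : ℕ) (l : List ℕ) :
      (enc (((List.range k).map (s + ·)).reverse ++ l)).size ≤
        (enc l).size + k * (2 * (s + k) + 2) := by
    induction k with
    | zero => simp
    | succ k ih =>
      rw [List.range_succ]
      simp only [List.map_append, List.reverse_append, List.map_cons, List.map_nil,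
        List.reverse_cons, List.reverse_nil, List.nil_append, enc_cons,
        List.cons_append, Data.size_cons, size_nat]
      nlinarith
  have h := foldl (step := fun x : (ℕ × List ℕ) × Unit => (x.1.1 + 1, x.1.1 :: x.1.2)) hf.units
    ((zero (α := α)).pair (nil (β := ℕ)))
    (fst'.fst.succ.pair (fst'.fst.cons fst'.snd)) (10 * .X + 10 * .X * .X) (fun l s => by
      rw [hfold, enc_pair, Data.size_cons, size_nat]
      have h1 := hsize l.length s.1 s.2
      have h2 := length_le_size l
      obtain ⟨s, s'⟩ := s
      simp only [enc_pair, Data.size_cons, size_nat, Polynomial.eval_add, Polynomial.eval_mul,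
        Polynomial.eval_X, Polynomial.eval_ofNat] at *
      nlinarith)
  convert h.snd.reverse using 2
  rw [hfold]
  simp

lemma drop {f : α → List β} {g : α → ℕ} (hf : PolyTime f) (hg : PolyTime g) :
    PolyTime (fun a => (f a).drop (g a)) := by
  have h := foldl (step := fun x : List β × Unit => x.1.tail) hg.units hf fst'.tail .X
    (fun l s => by
      induction l generalizing s with
      | nil => simp
      | cons b l ih =>
        refine (ih _).trans ?_
        have : (enc s.tail).size ≤ (enc s).size := by
          cases s with
          | nil => simp
          | cons a s => simp [enc_cons]; omega
        simp [enc_cons]; omega)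
  convert h using 2 with a
  generalize f a = l
  induction g a generalizing l with
  | zero => simp
  | succ n ih => rw [List.replicate_succ, List.foldl_cons, ← ih]; simp

lemma getD {f : α → List ℕ} {g : α → ℕ} (hf : PolyTime f) (hg : PolyTime g) :
    PolyTime (fun a => (f a).getD (g a) 0) := by
  convert (hf.drop hg).headD using 2
  simp [List.headD_eq_head?_getD, List.head?_drop]

lemma eval (p : Polynomial ℕ) : PolyTime (fun n : ℕ => p.eval n) := by
  induction p using Polynomial.induction_on' with
  | add p q hp hq => simpa using hp.add hq
  | monomial n c =>
    have : PolyTime (fun k : ℕ => k ^ n) := by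
      induction n with
      | zero => exact natConst 1
      | succ n ih => exact ih.mul id
    simpa using (natConst c).mul this

end PolyTime

/-- The tree of 1ⁿ has 2n + 1 nodes, so polynomials in n and in the input size give the same bounds.
-/
lemma polyTimeGenerated_iff (f : ℕ → α) :
    PolyTimeGenerated (fun n => enc (f n)) ↔ PolyTime f := by
  constructor
  · rintro ⟨P, p, h⟩
    refine ⟨P, p, fun n => ?_⟩
    obtain ⟨t, ht, hr⟩ := h n
    exact ⟨t, ht.trans (eval_mono p (by rw [PolyTime.size_nat]; omega)), hr⟩
  · rintro ⟨P, p, h⟩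
    refine ⟨P, p.comp (2 * .X + 1), fun n => ?_⟩
    obtain ⟨t, ht, hr⟩ := h n
    refine ⟨t, ht.trans ?_, hr⟩
    simp [PolyTime.size_nat]

end

end QCrypto

namespace QCrypto

open Matrix
open scoped ComplexOrder

/-! ### Matrices on assignments of bits -/

section Lift
variable {V W : Type} [Fintype V] [DecidableEq V] [Fintype W] [DecidableEq W]

/-- The operator on the wires `W` that acts as `M` on the wires `f v` and as the identity on the
other wires. -/
def lift (f : V → W) (M : Matrix (V → Bool) (V → Bool) ℂ) : Matrix (W → Bool) (W → Bool) ℂ :=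
  .of fun y z => if ∀ w ∉ Set.range f, y w = z w then M (y ∘ f) (z ∘ f) else 0

/-- An assignment is determined by its values on and off the range of `f`. Most identities between
assignments of wires below are checked through this criterion. -/
lemma eq_extend_iff {f : V → W} (hf : f.Injective) (x y : W → Bool) (v : V → Bool) :
    x = Function.extend f v y ↔ x ∘ f = v ∧ ∀ w ∉ Set.range f, x w = y w := by
  constructor
  · rintro rfl
    exact ⟨funext fun a => hf.extend_apply _ _ _, fun w hw => Function.extend_apply' _ _ _ hw⟩
  · rintro ⟨rfl, h⟩
    funext w
    by_cases hw : w ∈ Set.range f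
    · obtain ⟨a, rfl⟩ := hw
      simp [hf.extend_apply]
    · rw [h w hw, Function.extend_apply' _ _ _ hw]

lemma sum_agree {R : Type*} [AddCommMonoid R] {f : V → W} (hf : f.Injective) (y : W → Bool)
    (F : (W → Bool) → R) :
    (∑ x, if ∀ w ∉ Set.range f, x w = y w then F x else 0) =
      ∑ v : V → Bool, F (Function.extend f v y) := by
  rw [← Finset.sum_filter]
  refine Finset.sum_nbij' (fun x => x ∘ f) (fun v => Function.extend f v y) ?_ ?_ ?_ ?_ ?_
  · simp
  · intro v _
    simpa using fun w hw => Function.extend_apply' (f := f) v y w (by simpa using hw)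
  · intro x hx
    exact ((eq_extend_iff hf _ _ _).2 ⟨rfl, by simpa using hx⟩).symm
  · intro v _
    exact funext fun a => hf.extend_apply _ _ _
  · intro x hx
    rw [← (eq_extend_iff hf _ _ _).2 ⟨rfl, by simpa using hx⟩]

lemma extend_comp {f : V → W} (hf : f.Injective) (v : V → Bool) (y : W → Bool) :
    Function.extend f v y ∘ f = v := ((eq_extend_iff hf _ _ _).1 rfl).1

lemma extend_off {f : V → W} (v : V → Bool) (y : W → Bool) {w : W} (hw : w ∉ Set.range f) :
    Function.extend f v y w = y w := Function.extend_apply' _ _ _ hw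

/-- A local operator only changes the wires in the range of `f`, so the sum over intermediate basis
states runs over those wires alone. -/
lemma sum_lift_mul {R : Type*} [Fintype R] {f : V → W} (hf : f.Injective)
    (M : Matrix (V → Bool) (V → Bool) ℂ)
    (N : Matrix R (W → Bool) ℂ) (y : R) (z : W → Bool) :
    (N * lift f M) y z = ∑ v, N y (Function.extend f v z) * M v (z ∘ f) := by
  rw [mul_apply]
  have : ∀ x, N y x * lift f M x z =
      if ∀ w ∉ Set.range f, x w = z w then N y x * M (x ∘ f) (z ∘ f) else 0 := by
    intro x; simp only [lift, of_apply]; split_ifs <;> simp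
  simp only [this]
  rw [sum_agree hf]
  simp only [extend_comp hf]

lemma lift_mul {f : V → W} (hf : f.Injective) (M N : Matrix (V → Bool) (V → Bool) ℂ) :
    lift f (M * N) = lift f M * lift f N := by
  ext y z
  rw [sum_lift_mul hf]
  have : ∀ v, (∀ w ∉ Set.range f, y w = Function.extend f v z w) ↔
      ∀ w ∉ Set.range f, y w = z w := fun v =>
    forall₂_congr fun w hw => by rw [extend_off v z hw]
  simp only [lift, of_apply, this, extend_comp hf, mul_apply]
  split_ifs <;> simp

lemma lift_one {f : V → W} (hf : f.Injective) : lift f (1 : Matrix (V → Bool) (V → Bool) ℂ) = 1 := by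
  ext y z
  simp only [lift, of_apply, one_apply]
  have : y = z ↔ (y ∘ f = z ∘ f ∧ ∀ w ∉ Set.range f, y w = z w) := by
    rw [← eq_extend_iff hf]
    rw [← (eq_extend_iff hf z z _).2 ⟨rfl, fun _ _ => rfl⟩]
  simp only [this]
  split_ifs <;> simp_all

lemma lift_conjTranspose (f : V → W) (M : Matrix (V → Bool) (V → Bool) ℂ) :
    lift f Mᴴ = (lift f M)ᴴ := by
  ext y z
  simp only [lift, of_apply, conjTranspose_apply, eq_comm (a := y _)]
  split_ifs <;> simp

end Lift

/-- The matrix of a function on basis states. -/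
def funMatrix {X Y : Type} [DecidableEq Y] (F : X → Y) : Matrix Y X ℂ :=
  .of fun y x => if y = F x then 1 else 0

section FunMatrix
variable {X Y Z : Type} [Fintype X] [DecidableEq X] [Fintype Y] [DecidableEq Y] [Fintype Z]
  [DecidableEq Z]

lemma mul_funMatrix_apply (M : Matrix Z Y ℂ) (F : X → Y) (z : Z) (x : X) :
    (M * funMatrix F) z x = M z (F x) := by
  simp [mul_apply, funMatrix]

lemma funMatrix_mul (F : Y → Z) (G : X → Y) :
    funMatrix F * funMatrix G = funMatrix (F ∘ G) := by
  ext z x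
  rw [mul_funMatrix_apply]; simp [funMatrix]

lemma funMatrix_id : funMatrix (fun x : X => x) = 1 := by
  ext y x
  simp [funMatrix, one_apply]

lemma funMatrix_isometry {F : X → Y} (hF : F.Injective) : (funMatrix F)ᴴ * funMatrix F = 1 := by
  ext x y
  rw [mul_funMatrix_apply]
  simp [funMatrix, one_apply, hF.eq_iff, eq_comm]

/-- For recognising `σ` as `ρ` embedded along `F`: it suffices to compare entries on the range and
to see zeros elsewhere. Adjoining a register in a basis state has this form. -/
lemma funMatrix_conj {F : X → Y} (hF : F.Injective) (ρ : Matrix X X ℂ) (σ : Matrix Y Y ℂ)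
    (h1 : ∀ x x', σ (F x) (F x') = ρ x x')
    (h2 : ∀ y y', (y ∉ Set.range F ∨ y' ∉ Set.range F) → σ y y' = 0) :
    σ = funMatrix F * ρ * (funMatrix F)ᴴ := by
  ext y y'
  have h : ∀ x, (funMatrix F * ρ) y x = if h : y ∈ Set.range F then ρ h.choose x else 0 := by
    intro x
    simp only [mul_apply, funMatrix, of_apply, ite_mul, one_mul, zero_mul]
    split_ifs with h
    · have hh := h.choose_spec
      rw [Finset.sum_eq_single h.choose]
      · simp [hh]
      · intro b _ hb
        rw [if_neg]; intro e; exact hb (hF (e.symm.trans hh.symm))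
      · simp
    · exact Finset.sum_eq_zero fun b _ => if_neg fun e => h ⟨b, e.symm⟩
  rw [mul_apply]
  simp only [h, conjTranspose_apply]
  simp only [funMatrix, of_apply]
  split_ifs with hy
  · have hh := hy.choose_spec
    by_cases hy' : y' ∈ Set.range F
    · obtain ⟨x', rfl⟩ := hy'
      rw [Finset.sum_eq_single x']
      · simp [← h1, hh]
      · intro b _ hb
        rw [if_neg (fun e => hb (hF e.symm))]; simp
      · simp
    · rw [h2 _ _ (Or.inr hy')]
      refine (Finset.sum_eq_zero fun b _ => ?_).symm
      rw [if_neg fun e => hy' ⟨b, e.symm⟩]; simp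
  · rw [h2 _ _ (Or.inl hy)]; simp

end FunMatrix

/-! ### Gates -/

/-- Relabel the wires of a gate. -/
def Gate.map {V W : Type} (f : V ↪ W) : Gate V → Gate W
  | .x a => .x (f a)
  | .h a => .h (f a)
  | .t a => .t (f a)
  | .tdg a => .tdg (f a)
  | .cnot a b hab => .cnot (f a) (f b) (f.injective.ne hab)
  | .ccx a b c hab hac hbc =>
      .ccx (f a) (f b) (f c) (f.injective.ne hab) (f.injective.ne hac) (f.injective.ne hbc)

section Gates
variable {V W : Type} [Fintype V] [DecidableEq V] [Fintype W] [DecidableEq W]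

lemma eq_update_iff (f : V ↪ W) (y z : W → Bool) (a : V) (c : Bool) :
    y = Function.update z (f a) c ↔
      (∀ w ∉ Set.range f, y w = z w) ∧ y ∘ f = Function.update (z ∘ f) a c := by
  rw [and_comm, ← eq_extend_iff f.injective]
  suffices Function.update z (f a) c =
      Function.extend f (Function.update (z ∘ f) a c) z by rw [this]
  rw [eq_extend_iff f.injective]
  refine ⟨?_, fun w hw => Function.update_of_ne (fun e => hw ⟨a, e.symm⟩) _ _⟩
  exact Function.update_comp_eq_of_injective _ f.injective _ _

lemma Gate.matrix_map (f : V ↪ W) (g : Gate V) : (g.map f).matrix = lift f g.matrix := by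
  ext y z
  cases g with
  | x a =>
    simp only [Gate.map, Gate.matrix, lift, of_apply, eq_update_iff, ite_and, Function.comp_apply]
  | cnot a b =>
    simp only [Gate.map, Gate.matrix, lift, of_apply, eq_update_iff, ite_and, Function.comp_apply]
  | ccx a b c =>
    simp only [Gate.map, Gate.matrix, lift, of_apply, eq_update_iff, ite_and, Function.comp_apply]
  | h a =>
    simp only [Gate.map, Gate.matrix, lift, of_apply, ← ite_and, Function.comp_apply]
    congr 1
    refine propext ⟨fun h => ⟨fun w hw => h w fun e => hw ⟨a, e.symm⟩,
      fun v hv => h _ (f.injective.ne hv)⟩, fun ⟨h1, h2⟩ w hw => ?_⟩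
    by_cases hr : w ∈ Set.range f
    · obtain ⟨v, rfl⟩ := hr
      exact h2 v fun e => hw (e ▸ rfl)
    · exact h1 w hr
  | t a =>
    -- A diagonal gate has the support of the identity, so the comparison of indices is taken from
    -- `lift_one`.
    have h := congrFun (congrFun (lift_one (V := V) f.injective) y) z
    simp only [lift, of_apply, one_apply] at h
    simp only [Gate.map, Gate.matrix, lift, of_apply, diagonal_apply]
    split_ifs at * <;> simp_all
  | tdg a =>
    have h := congrFun (congrFun (lift_one (V := V) f.injective) y) z
    simp only [lift, of_apply, one_apply] at h
    simp only [Gate.map, Gate.matrix, lift, of_apply, diagonal_apply]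
    split_ifs at * <;> simp_all

lemma gatesMatrix_nil : gatesMatrix ([] : List (Gate W)) = 1 := rfl

lemma gatesMatrix_append (l l' : List (Gate W)) :
    gatesMatrix (l ++ l') = gatesMatrix l' * gatesMatrix l := by
  have (l : List (Gate W)) (N) :
      l.foldl (fun M g => g.matrix * M) N = l.foldl (fun M g => g.matrix * M) 1 * N := by
    induction l generalizing N with
    | nil => simp
    | cons g l ih => rw [List.foldl_cons, List.foldl_cons, ih, ih (g.matrix * 1), mul_assoc, mul_one]
  rw [gatesMatrix, List.foldl_append, this]; rfl

lemma gatesMatrix_singleton (g : Gate W) : gatesMatrix [g] = g.matrix := by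
  simp [gatesMatrix]

lemma gatesMatrix_cons (g : Gate W) (l : List (Gate W)) :
    gatesMatrix (g :: l) = gatesMatrix l * g.matrix := by
  rw [← List.singleton_append, gatesMatrix_append, gatesMatrix_singleton]

lemma gatesMatrix_map (f : V ↪ W) (l : List (Gate V)) :
    gatesMatrix (l.map (Gate.map f)) = lift f (gatesMatrix l) := by
  induction l with
  | nil => exact (lift_one f.injective).symm
  | cons g l ih =>
    rw [List.map_cons, gatesMatrix_cons, gatesMatrix_cons, ih, lift_mul f.injective,
      Gate.matrix_map]

lemma funMatrix_involutive {F : (W → Bool) → (W → Bool)} (hF : Function.Involutive F) :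
    (funMatrix F)ᴴ = funMatrix F ∧ funMatrix F * funMatrix F = 1 := by
  constructor
  · ext y z
    simp only [funMatrix, conjTranspose_apply, of_apply, apply_ite star, star_one, star_zero]
    congr 1
    exact propext ⟨fun h => by rw [h, hF], fun h => by rw [h, hF]⟩
  · rw [funMatrix_mul, hF.comp_self]; exact funMatrix_id

/-- One wire suffices, since a Hadamard gate among other wires is a `lift` of this matrix. -/
lemma hadamard_aux : (Gate.h ()).matrixᴴ = (Gate.h ()).matrix ∧
    (Gate.h ()).matrix * (Gate.h ()).matrix = 1 := by
  have h2 : (Real.sqrt 2 : ℂ) * Real.sqrt 2 = 2 := by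
    rw [← Complex.ofReal_mul, Real.mul_self_sqrt (by norm_num)]; norm_num
  have h0 : (Real.sqrt 2 : ℂ) ≠ 0 := fun h => by simp [h] at h2
  have hU : ∀ w : Unit, ¬ (w ≠ ()) := by simp
  constructor
  · ext y z
    simp only [Gate.matrix, conjTranspose_apply, of_apply]
    cases y () <;> cases z () <;> simp
  · ext y z
    rw [mul_apply, ← (Equiv.funUnique Unit Bool).symm.sum_comp, Fintype.sum_bool]
    have : y = z ↔ y () = z () := ⟨fun h => h ▸ rfl, fun h => funext fun _ => h⟩
    simp only [Gate.matrix, of_apply, one_apply, this]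
    cases y () <;> cases z () <;> simp <;> field_simp <;> rw [sq, h2] <;> norm_num

/-- X, H, CNOT and Toffoli are involutions, and the phases of T and its inverse are eighth roots of
unity. With a common exponent every gate is inverted by seven repetitions, so inverting a circuit
needs no case distinction on its description. -/
lemma Gate.matrix_spec (g : Gate W) : g.matrixᴴ * g.matrix = 1 ∧ g.matrix ^ 8 = 1 := by
  have key : ∀ M : Matrix (W → Bool) (W → Bool) ℂ, Mᴴ = M ∧ M * M = 1 →
      Mᴴ * M = 1 ∧ M ^ 8 = 1 := fun M h => by
    refine ⟨by rw [h.1, h.2], ?_⟩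
    rw [show 8 = 2 * 4 from rfl, pow_mul, sq, h.2, one_pow]
  cases g with
  | x a =>
    refine key _ (funMatrix_involutive (F := fun z => Function.update z a (!z a)) fun z => ?_)
    simp
  | cnot a b hab =>
    refine key _ (funMatrix_involutive
      (F := fun z => Function.update z b (xor (z b) (z a))) fun z => ?_)
    simp [hab]
  | ccx a b c hab hac hbc =>
    refine key _ (funMatrix_involutive
      (F := fun z => Function.update z c (xor (z c) (z a && z b))) fun z => ?_)
    simp [hac, hbc]
  | h a =>
    refine key _ ?_
    have : (Gate.h a).matrix = lift (fun _ : Unit => a) (Gate.h ()).matrix :=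
      Gate.matrix_map ⟨fun _ => a, fun _ _ _ => rfl⟩ (Gate.h ())
    have hinj : Function.Injective (fun _ : Unit => a) := fun _ _ _ => rfl
    rw [this, ← lift_conjTranspose, hadamard_aux.1, ← lift_mul hinj, hadamard_aux.2, lift_one hinj]
    exact ⟨rfl, rfl⟩
  | t a =>
    simp only [Gate.matrix, diagonal_conjTranspose, diagonal_mul_diagonal, diagonal_pow,
      ← diagonal_one]
    constructor
    · congr 1; funext z
      by_cases hz : z a
      · simp only [hz, if_true, Pi.star_apply, RCLike.star_def, ← Complex.exp_conj, ← Complex.exp_add]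
        rw [← Complex.exp_zero]; congr 1; simp [map_ofNat]
      · simp [hz]
    · congr 1; funext z
      by_cases hz : z a
      · simp only [Pi.pow_apply, hz, if_true, ← Complex.exp_nat_mul]
        rw [← Complex.exp_two_pi_mul_I]; congr 1; push_cast; ring
      · simp [hz]
  | tdg a =>
    simp only [Gate.matrix, diagonal_conjTranspose, diagonal_mul_diagonal, diagonal_pow,
      ← diagonal_one]
    constructor
    · congr 1; funext z
      by_cases hz : z a
      · simp only [hz, if_true, Pi.star_apply, RCLike.star_def, ← Complex.exp_conj, ← Complex.exp_add]
        rw [← Complex.exp_zero]; congr 1; simp [map_ofNat]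
      · simp [hz]
    · congr 1; funext z
      by_cases hz : z a
      · simp only [Pi.pow_apply, hz, if_true, ← Complex.exp_nat_mul]
        rw [← _root_.inv_inj, ← Complex.exp_neg, inv_one, ← Complex.exp_two_pi_mul_I]
        congr 1; push_cast; ring
      · simp [hz]

lemma gatesMatrix_unitary (l : List (Gate W)) : (gatesMatrix l)ᴴ * gatesMatrix l = 1 := by
  induction l with
  | nil => simp [gatesMatrix_nil]
  | cons g l ih =>
    rw [gatesMatrix_cons, conjTranspose_mul, Matrix.mul_assoc, ← Matrix.mul_assoc _ _ g.matrix, ih,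
      Matrix.one_mul, g.matrix_spec.1]

/-- The inverse circuit: every gate is its own inverse up to the eighth power. -/
def inverseGates (l : List (Gate W)) : List (Gate W) :=
  l.reverse.flatMap fun g => [g, g, g, g, g, g, g]

lemma gatesMatrix_inverseGates (l : List (Gate W)) :
    gatesMatrix (inverseGates l) = (gatesMatrix l)ᴴ := by
  have hg (g : Gate W) : gatesMatrix [g, g, g, g, g, g, g] = g.matrixᴴ := by
    have h1 : gatesMatrix [g, g, g, g, g, g, g] = g.matrix ^ 7 := by
      simp only [gatesMatrix_cons, gatesMatrix_nil, pow_succ, pow_zero]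
    have h2 : g.matrix ^ 7 * g.matrix = 1 := by rw [← pow_succ, g.matrix_spec.2]
    rw [h1]
    exact left_inv_eq_right_inv h2 (mul_eq_one_comm.1 g.matrix_spec.1)
  induction l with
  | nil => simp [inverseGates, gatesMatrix_nil]
  | cons g l ih =>
    have : inverseGates (g :: l) = inverseGates l ++ [g, g, g, g, g, g, g] := by
      simp [inverseGates]
    rw [this, gatesMatrix_append, ih, hg, gatesMatrix_cons, conjTranspose_mul]

/-- No target is a source and the targets are distinct, so the gates do not disturb one another and
all the additions happen as if at once. -/
lemma gatesMatrix_cnots_aux {ι : Type} (src dst : ι → W) (hne : ∀ i j, src i ≠ dst j)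
    (hdst : dst.Injective) (L : List ι) (hL : L.Nodup) :
    ∃ F, gatesMatrix (L.map fun i => Gate.cnot (src i) (dst i) (hne i i)) = funMatrix F ∧
      (∀ z, ∀ i ∈ L, F z (dst i) = xor (z (dst i)) (z (src i))) ∧
      ∀ z w, (∀ i ∈ L, dst i ≠ w) → F z w = z w := by
  induction L with
  | nil => exact ⟨fun z => z, funMatrix_id.symm, by simp, by simp⟩
  | cons i L ih =>
    rw [List.nodup_cons] at hL
    obtain ⟨F, h1, h2, h3⟩ := ih hL.2
    refine ⟨F ∘ fun z => Function.update z (dst i) (xor (z (dst i)) (z (src i))), ?_, ?_, ?_⟩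
    · rw [List.map_cons, gatesMatrix_cons, h1, ← funMatrix_mul]; rfl
    · intro z j hj
      simp only [Function.comp_apply]
      rcases List.mem_cons.1 hj with rfl | hj
      · rw [h3]
        · simp
        · intro k hk e
          exact hL.1 (hdst e ▸ hk)
      · rw [h2 _ _ hj, Function.update_of_ne, Function.update_of_ne (hne _ _)]
        intro e
        exact hL.1 (hdst e ▸ hj)
    · intro z w hw
      simp only [Function.comp_apply]
      rw [h3 _ _ fun k hk => hw k (by simp [hk]), Function.update_of_ne]
      exact (hw i (by simp)).symm

/-- Add the wires `src i` to the wires `dst i`. -/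
def cnots {n : ℕ} (src dst : Fin n → W) (hne : ∀ i j, src i ≠ dst j) : List (Gate W) :=
  (List.finRange n).map fun i => .cnot (src i) (dst i) (hne i i)

lemma gatesMatrix_cnots {n : ℕ} (src dst : Fin n → W) (hne : ∀ i j, src i ≠ dst j)
    (hdst : dst.Injective) :
    gatesMatrix (cnots src dst hne) = funMatrix fun z =>
      Function.extend dst (fun i => xor (z (dst i)) (z (src i))) z := by
  obtain ⟨F, h1, h2, h3⟩ :=
    gatesMatrix_cnots_aux src dst hne hdst (List.finRange n) (List.nodup_finRange n)
  rw [cnots, h1]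
  congr 1
  funext z
  rw [eq_extend_iff hdst]
  exact ⟨funext fun i => h2 z i (List.mem_finRange i), fun w hw => h3 z w fun i _ e => hw ⟨i, e⟩⟩

end Gates

/-! ### Channels of circuits -/

section Reduce
variable {b n : ℕ}

/-- The column index is forced: it agrees with `x` on the discarded wires and with `y'` on the
output. -/
lemma reduceTo_apply (out : Fin b ↪ Fin n) (M : Op n) (y y' : Bits b) :
    reduceTo out M y y' = ∑ x, if x ∘ out = y then M x (Function.extend out y' x) else 0 := by
  simp only [reduceTo, of_apply]
  refine Finset.sum_congr rfl fun x _ => ?_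
  have h : ∀ x', ((∀ i, x (out i) = y i) ∧ (∀ i, x' (out i) = y' i) ∧
      ∀ w ∉ Set.range out, x w = x' w) ↔ x ∘ out = y ∧ x' = Function.extend out y' x := by
    intro x'
    rw [eq_extend_iff out.injective]
    simp only [funext_iff, Function.comp_apply, eq_comm (a := x _) (b := x' _)]
  simp only [h, ite_and]
  split_ifs with hx <;> simp

lemma reduceTo_diag (out : Fin b ↪ Fin n) (M : Op n) (y : Bits b) :
    reduceTo out M y y = ∑ x, if x ∘ out = y then M x x else 0 := by
  rw [reduceTo_apply]
  refine Finset.sum_congr rfl fun x _ => ?_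
  split_ifs with hx
  · rw [← (eq_extend_iff out.injective x x y).2 ⟨hx, fun _ _ => rfl⟩]
  · rfl

lemma trace_reduceTo (out : Fin b ↪ Fin n) (M : Op n) : (reduceTo out M).trace = M.trace := by
  simp only [trace, diag, reduceTo_diag]
  rw [Finset.sum_comm]
  simp

/-- There is one principal submatrix for each assignment of the discarded wires, represented by the
`r` that vanishes on the output wires. Positivity of the partial trace follows. -/
lemma reduceTo_eq_sum (out : Fin b ↪ Fin n) (M : Op n) :
    reduceTo out M = ∑ r : Bits n with r ∘ out = fun _ => false,
      M.submatrix (fun y => Function.extend out y r) (fun y => Function.extend out y r) := by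
  ext y y'
  rw [reduceTo_apply, Matrix.sum_apply, ← Finset.sum_filter]
  have hinj := out.injective
  refine Finset.sum_nbij' (fun x => Function.extend out (fun _ => false) x)
    (fun r => Function.extend out y r) ?_ ?_ ?_ ?_ ?_
  · intro x _
    simp [extend_comp hinj]
  · intro x _
    simp [extend_comp hinj]
  · intro x hx
    exact ((eq_extend_iff hinj _ _ _).2
      ⟨by simpa using hx, fun w hw => (extend_off _ _ hw).symm⟩).symm
  · intro x hx
    exact ((eq_extend_iff hinj _ _ _).2
      ⟨by simpa using hx, fun w hw => (extend_off _ _ hw).symm⟩).symm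
  · intro x hx
    have h : ∀ v, Function.extend out v (Function.extend out (fun _ => false) x) =
        Function.extend out v x := fun v => by
      rw [eq_extend_iff hinj]
      exact ⟨extend_comp hinj _ _, fun w hw => by rw [extend_off _ _ hw, extend_off _ _ hw]⟩
    rw [submatrix_apply, h, h, ← (eq_extend_iff hinj x x y).2 ⟨by simpa using hx, fun _ _ => rfl⟩]

lemma reduceTo_posSemidef (out : Fin b ↪ Fin n) {M : Op n} (hM : M.PosSemidef) :
    (reduceTo out M).PosSemidef := by
  rw [reduceTo_eq_sum]
  exact posSemidef_sum _ fun r _ => hM.submatrix _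

end Reduce

/-! ### Circuits as isometries followed by a partial trace -/

section Circuit
variable {a b κ m : ℕ}

lemma append_injective (z : Bits b) : (fun p : Bits a => (Fin.append p z : Bits (a + b))).Injective :=
  fun p q h => funext fun i => by
    simpa using congrFun h (Fin.castAdd b i)

lemma append_injective_right (z : Bits a) :
    (fun p : Bits b => (Fin.append z p : Bits (a + b))).Injective :=
  fun p q h => funext fun i => by
    simpa using congrFun h (Fin.natAdd a i)

lemma tensor_ket (ρ : Op a) (z : Bits b) :
    tensor ρ (ket z) = funMatrix (fun p : Bits a => (Fin.append p z : Bits (a + b))) * ρ *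
      (funMatrix (fun p : Bits a => (Fin.append p z : Bits (a + b))))ᴴ := by
  have hr : ∀ y : Bits (a + b), (y ∉ Set.range fun p : Bits a => (Fin.append p z : Bits (a + b))) →
      z ≠ fun i => y (Fin.natAdd a i) := by
    rintro y hy rfl
    exact hy ⟨fun i => y (Fin.castAdd b i), Fin.append_castAdd_natAdd⟩
  refine funMatrix_conj (append_injective z) ρ _ ?_ ?_
  · intro x x'
    simp [tensor, ket]
  · rintro y y' h
    simp only [tensor, ket, of_apply, single_apply]
    rw [if_neg, mul_zero]
    rintro ⟨h1, h2⟩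
    exact h.elim (fun h => hr y h h1) (fun h => hr y' h h2)

lemma ket_tensor (k : Bits a) (ρ : Op b) :
    tensor (ket k) ρ = funMatrix (fun p : Bits b => (Fin.append k p : Bits (a + b))) * ρ *
      (funMatrix (fun p : Bits b => (Fin.append k p : Bits (a + b))))ᴴ := by
  have hr : ∀ y : Bits (a + b), (y ∉ Set.range fun p : Bits b => (Fin.append k p : Bits (a + b))) →
      k ≠ fun i => y (Fin.castAdd b i) := by
    rintro y hy rfl
    exact hy ⟨fun i => y (Fin.natAdd a i), Fin.append_castAdd_natAdd⟩
  refine funMatrix_conj (append_injective_right k) ρ _ ?_ ?_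
  · intro x x'
    simp [tensor, ket]
  · rintro y y' h
    simp only [tensor, ket, of_apply, single_apply]
    rw [if_neg, zero_mul]
    rintro ⟨h1, h2⟩
    exact h.elim (fun h => hr y h h1) (fun h => hr y' h h2)

/-- The isometry of a circuit, before the discarded wires are traced out. -/
noncomputable def QCircuit.iso (C : QCircuit a b) : Matrix (Bits (a + C.anc)) (Bits a) ℂ :=
  gatesMatrix C.gates * funMatrix fun p : Bits a => (Fin.append p fun _ => false : Bits (a + C.anc))

lemma QCircuit.iso_isometry (C : QCircuit a b) : C.isoᴴ * C.iso = 1 := by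
  rw [QCircuit.iso, conjTranspose_mul, Matrix.mul_assoc, ← Matrix.mul_assoc _ _ (funMatrix _),
    gatesMatrix_unitary, Matrix.one_mul, funMatrix_isometry (append_injective _)]

lemma QCircuit.run_eq (C : QCircuit a b) (ρ : Op a) :
    C.run ρ = reduceTo C.out (C.iso * ρ * C.isoᴴ) := by
  rw [QCircuit.run, tensor_ket, QCircuit.iso, conjTranspose_mul]
  simp only [Matrix.mul_assoc]

lemma QCircuit.run_posSemidef (C : QCircuit a b) {ρ : Op a} (hρ : ρ.PosSemidef) :
    (C.run ρ).PosSemidef := by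
  rw [C.run_eq]
  exact reduceTo_posSemidef _ (hρ.mul_mul_conjTranspose_same _)

lemma QCircuit.trace_run (C : QCircuit a b) (ρ : Op a) : (C.run ρ).trace = ρ.trace := by
  rw [C.run_eq, trace_reduceTo, trace_mul_comm, ← Matrix.mul_assoc, C.iso_isometry, Matrix.one_mul]

lemma QCircuit.prob_nonneg (C : QCircuit a b) {ρ : Op a} (hρ : ρ.PosSemidef) (y : Bits b) :
    0 ≤ C.prob ρ y :=
  (Complex.le_def.1 ((C.run_posSemidef hρ).diag_nonneg (i := y))).1

lemma QCircuit.run_diag (C : QCircuit a b) {ρ : Op a} (hρ : ρ.PosSemidef) (y : Bits b) :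
    C.run ρ y y = C.prob ρ y :=
  Complex.ext rfl
    (by simpa using (Complex.le_def.1 ((C.run_posSemidef hρ).diag_nonneg (i := y))).2.symm)

lemma QCircuit.sum_prob (C : QCircuit a b) (ρ : Op a) :
    ∑ y, C.prob ρ y = ρ.trace.re := by
  rw [← C.trace_run, trace, Complex.re_sum]; rfl

lemma ket_posSemidef (k : Bits a) : (ket k).PosSemidef := by
  have : ket k = vecMulVec (Pi.single k 1) (star (Pi.single k 1)) := by
    rw [← Pi.single_star, star_one]
    exact single_eq_single_vecMulVec_single k k
  rw [this]
  exact posSemidef_vecMulVec_self_star _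

lemma trace_ket (k : Bits a) : (ket k).trace = 1 := by
  simp [ket]

lemma tensor_posSemidef (k : Bits a) {ρ : Op b} (hρ : ρ.PosSemidef) :
    (tensor (ket k) ρ).PosSemidef := by
  rw [ket_tensor]
  exact hρ.mul_mul_conjTranspose_same _

lemma trace_tensor (k : Bits a) (ρ : Op b) : (tensor (ket k) ρ).trace = ρ.trace := by
  rw [ket_tensor, trace_mul_comm, ← Matrix.mul_assoc,
    funMatrix_isometry (append_injective_right k), Matrix.one_mul]

end Circuit

end QCrypto

namespace QCrypto

open Matrix
open scoped ComplexOrder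

/-! ### Circuits on labelled wires -/

lemma funMatrix_conj_apply {X Y : Type} [Fintype X] [DecidableEq X] [Fintype Y] [DecidableEq Y]
    {F : X → Y} (hF : F.Injective) (M : Matrix X X ℂ) (x x' : X) :
    (funMatrix F * M * (funMatrix F)ᴴ) (F x) (F x') = M x x' := by
  have h : ∀ x', (funMatrix F * M) (F x) x' = M x x' := fun x' => by
    simp [mul_apply, funMatrix, hF.eq_iff]
  simp only [mul_apply (M := funMatrix F * M), h]
  simp [conjTranspose_apply, funMatrix, hF.eq_iff]

/-- The circuit with the gates `l`, whose wires `W` are numbered by `e`. -/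
def QCircuit.ofWires {a b anc : ℕ} {W : Type} (e : W ≃ Fin (a + anc)) (l : List (Gate W))
    (o : Fin b ↪ W) : QCircuit a b :=
  ⟨anc, l.map (Gate.map e.toEmbedding), o.trans e.toEmbedding⟩

section OfWires
variable {a b anc : ℕ} {W : Type} [Fintype W] [DecidableEq W]

lemma lift_equiv {V : Type} [Fintype V] [DecidableEq V] (e : V ≃ W)
    (M : Matrix (V → Bool) (V → Bool) ℂ) (y z : W → Bool) :
    lift e.toEmbedding M y z = M (y ∘ e) (z ∘ e) := by
  simp [lift]

/-- Renumbering the wires conjugates everything by a permutation of basis states. The circuits below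
can therefore be analysed on structured wire types, without index arithmetic. -/
lemma QCircuit.run_of_wires (C : QCircuit a b) (e : W ≃ Fin (a + C.anc)) (l : List (Gate W))
    (o : Fin b ↪ W) (hg : C.gates = l.map (Gate.map e.toEmbedding))
    (ho : C.out = o.trans e.toEmbedding) (ρ : Op a) (y y' : Bits b) :
    C.run ρ y y' = ∑ x : W → Bool, if x ∘ o = y then
      ((gatesMatrix l * funMatrix fun p : Bits a => (Fin.append p fun _ => false) ∘ e) * ρ *
        (gatesMatrix l * funMatrix fun p : Bits a => (Fin.append p fun _ => false) ∘ e)ᴴ) x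
        (Function.extend o y' x) else 0 := by
  have hiso : C.iso.submatrix (Equiv.arrowCongr e (Equiv.refl Bool)) id =
      gatesMatrix l * funMatrix fun p : Bits a => (Fin.append p fun _ => false) ∘ e := by
    ext x p
    rw [mul_funMatrix_apply, submatrix_apply, QCircuit.iso, mul_funMatrix_apply, hg,
      gatesMatrix_map, lift_equiv]
    congr 1
    funext i; simp
  have hM : (C.iso * ρ * C.isoᴴ).submatrix (Equiv.arrowCongr e (Equiv.refl Bool))
      (Equiv.arrowCongr e (Equiv.refl Bool)) =
      C.iso.submatrix (Equiv.arrowCongr e (Equiv.refl Bool)) id * ρ *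
      (C.iso.submatrix (Equiv.arrowCongr e (Equiv.refl Bool)) id)ᴴ := rfl
  rw [QCircuit.run_eq, reduceTo_apply, ← hiso, ← hM,
    ← (Equiv.arrowCongr e (Equiv.refl Bool)).sum_comp]
  refine Finset.sum_congr rfl fun x _ => ?_
  have h1 : (Equiv.arrowCongr e (Equiv.refl Bool) x : Bits (a + C.anc)) ∘ C.out = x ∘ o := by
    funext i; simp [ho]
  have h3 : Function.extend C.out y' (Equiv.arrowCongr e (Equiv.refl Bool) x)
      = Equiv.arrowCongr e (Equiv.refl Bool) (Function.extend o y' x) := by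
    refine ((eq_extend_iff C.out.injective _ _ _).2 ⟨?_, ?_⟩).symm
    · funext i; simp [ho, o.injective.extend_apply]
    · intro w hw
      simp only [Equiv.arrowCongr_apply, Function.comp_apply, Equiv.refl_apply]
      rw [extend_off]
      rintro ⟨i, hi⟩
      exact hw ⟨i, by simp [ho, hi]⟩
  rw [h1, h3, submatrix_apply]

lemma QCircuit.run_ofWires (e : W ≃ Fin (a + anc)) (l : List (Gate W)) (o : Fin b ↪ W) (ρ : Op a)
    (y y' : Bits b) :
    (QCircuit.ofWires e l o).run ρ y y' = ∑ x : W → Bool, if x ∘ o = y then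
      ((gatesMatrix l * funMatrix fun p : Bits a => (Fin.append p fun _ => false) ∘ e) * ρ *
        (gatesMatrix l * funMatrix fun p : Bits a => (Fin.append p fun _ => false) ∘ e)ᴴ) x
        (Function.extend o y' x) else 0 :=
  (QCircuit.ofWires e l o).run_of_wires e l o rfl rfl ρ y y'

end OfWires

lemma QCircuit.run_ket_apply {κ m : ℕ} (M : QCircuit κ m) (k : Bits κ) (y y' : Bits m) :
    M.run (ket k) y y' = ∑ w, if w ∘ M.out = y then
      gatesMatrix M.gates w (Fin.append k fun _ => false) *
        star (gatesMatrix M.gates (Function.extend M.out y' w) (Fin.append k fun _ => false))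
      else 0 := by
  rw [M.run_eq, reduceTo_apply]
  refine Finset.sum_congr rfl fun w _ => ?_
  congr 1
  have : (M.iso * ket k) w = fun x => if x = k then M.iso w k else 0 := by
    funext x
    simp [ket, mul_apply, single_apply, ite_and, eq_comm]
  rw [mul_apply, this]
  simp [QCircuit.iso, mul_funMatrix_apply]

/-! ### A chain of Toffoli gates that tests whether a register is zero -/

section Chain
variable {N : ℕ} {W : Type} [Fintype W] [DecidableEq W]

/-- Flip the last wire `C N` if all the wires `R w` are zero, for `C` initially zero. -/
def zeroTest (R : Fin N ↪ W) (C : Fin (N + 1) ↪ W) (hRC : ∀ w j, C j ≠ R w) : List (Gate W) :=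
  .x (C 0) :: (List.finRange N).flatMap fun w =>
    [.x (R w), .ccx (C w.castSucc) (R w) (C w.succ) (hRC _ _)
      (C.injective.ne (Fin.castSucc_lt_succ).ne) (hRC _ _).symm]

lemma update_bijective (a : W) (f : (W → Bool) → Bool)
    (hf : ∀ z c, f (Function.update z a c) = f z) :
    (fun z : W → Bool => Function.update z a (xor (z a) (f z))).Bijective :=
  Function.Involutive.bijective fun z => by simp [hf]

/-- After `j` rounds the test wire `C j` holds the conjunction of the negated first `j` register
wires. The last two clauses say that the wires of later rounds are still fresh. The register wires
already tested stay negated. -/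
lemma gatesMatrix_zeroTest_aux (R : Fin N ↪ W) (C : Fin (N + 1) ↪ W) (hRC : ∀ w j, C j ≠ R w)
    (j : ℕ) (hj : j ≤ N) :
    ∃ F, gatesMatrix (.x (C 0) :: ((List.finRange N).take j).flatMap fun w =>
      [.x (R w), .ccx (C w.castSucc) (R w) (C w.succ) (hRC _ _)
        (C.injective.ne (Fin.castSucc_lt_succ).ne) (hRC _ _).symm]) = funMatrix F ∧
      F.Bijective ∧ ∀ y, (∀ i, y (C i) = false) →
        (F y (C ⟨j, by omega⟩) = true ↔ ∀ w : Fin N, w < j → y (R w) = false) ∧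
        (∀ i : Fin (N + 1), j < i → F y (C i) = false) ∧
        ∀ w : Fin N, j ≤ w → F y (R w) = y (R w) := by
  induction j with
  | zero =>
    refine ⟨fun z => Function.update z (C 0) (!z (C 0)), ?_, ?_, fun y hy => ⟨?_, ?_, ?_⟩⟩
    · simp [gatesMatrix_singleton]; rfl
    · simpa using update_bijective (C 0) (fun _ => true) fun _ _ => rfl
    · simp [hy]
    · intro i hi
      exact (Function.update_of_ne (C.injective.ne (Fin.pos_iff_ne_zero.1 hi)) _ _).trans (hy i)
    · intro w _
      exact Function.update_of_ne (hRC _ _).symm _ _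
  | succ j ih =>
    obtain ⟨F, h1, h2, h3⟩ := ih (by omega)
    set w : Fin N := ⟨j, hj⟩ with hw
    refine ⟨(fun z => Function.update z (C w.succ)
        (xor (z (C w.succ)) (z (C w.castSucc) && z (R w)))) ∘
      (fun z => Function.update z (R w) (!z (R w))) ∘ F, ?_, ?_, fun y hy => ?_⟩
    · have : (List.finRange N).take (j + 1) = (List.finRange N).take j ++ [w] := by
        rw [List.take_add_one, List.getElem?_eq_getElem (by simpa using hj)]
        simp [hw]
      rw [this, List.flatMap_append, ← List.cons_append, gatesMatrix_append, h1, ← funMatrix_mul,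
        ← funMatrix_mul]
      simp only [List.flatMap_cons, List.flatMap_nil, List.append_nil, gatesMatrix_cons,
        gatesMatrix_nil, Matrix.one_mul, Matrix.mul_assoc]
      rfl
    · refine (update_bijective _ (fun z => z (C w.castSucc) && z (R w)) fun z c => ?_).comp
        (.comp ?_ h2)
      · rw [Function.update_of_ne (C.injective.ne (Fin.castSucc_lt_succ).ne),
          Function.update_of_ne (hRC _ _).symm]
      · simpa using update_bijective (R w) (fun _ => true) fun _ _ => rfl
    · obtain ⟨h4, h5, h6⟩ := h3 y hy
      refine ⟨?_, fun i hi => ?_, fun v hv => ?_⟩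
      · have e1 : (⟨j + 1, by omega⟩ : Fin (N + 1)) = w.succ := rfl
        have e2 : (⟨j, by omega⟩ : Fin (N + 1)) = w.castSucc := rfl
        rw [e2] at h4
        simp only [e1, Function.comp_apply, Function.update_self, Function.update_of_ne (hRC _ _),
          h5 w.succ (by simp [hw]), h6 w le_rfl, Bool.false_bne, Bool.and_eq_true, h4,
          Bool.not_eq_true']
        constructor
        · rintro ⟨h, h'⟩ v hv
          rcases Nat.lt_succ_iff_lt_or_eq.1 hv with hv | hv
          · exact h v hv
          · rwa [show v = w from Fin.ext hv]
        · exact fun h => ⟨fun v hv => h v (by omega), h w (by simp [hw])⟩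
      · have : i ≠ w.succ := fun e => by simp [e, hw] at hi
        simp only [Function.comp_apply]
        rw [Function.update_of_ne (C.injective.ne this), Function.update_of_ne (hRC _ _)]
        exact h5 i (by omega)
      · have : v ≠ w := fun e => by simp [e, hw] at hv
        simp only [Function.comp_apply]
        rw [Function.update_of_ne (hRC _ _).symm, Function.update_of_ne (R.injective.ne this)]
        exact h6 v (by omega)

lemma gatesMatrix_zeroTest (R : Fin N ↪ W) (C : Fin (N + 1) ↪ W) (hRC : ∀ w j, C j ≠ R w) :
    ∃ F, gatesMatrix (zeroTest R C hRC) = funMatrix F ∧ F.Bijective ∧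
      ∀ y, (∀ i, y (C i) = false) → (F y (C (Fin.last N)) = true ↔ ∀ w, y (R w) = false) := by
  obtain ⟨F, h1, h2, h3⟩ := gatesMatrix_zeroTest_aux R C hRC N le_rfl
  refine ⟨F, ?_, h2, fun y hy => ?_⟩
  · rw [← h1, zeroTest, List.take_of_length_le (by simp)]
  · exact (h3 y hy).1.trans ⟨fun h w => h w w.2, fun h w _ => h w⟩

end Chain

/-! ### The projection onto the output state of a circuit -/

section Proj
variable {κ m : ℕ}

/-- The wires of `projCircuit`: the key, the state, a register on which the circuit `M` runs, and
the wires of the zero test. -/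
abbrev ProjWire (M : QCircuit κ m) : Type :=
  (Fin κ ⊕ Fin m) ⊕ (Fin (κ + M.anc) ⊕ Fin (κ + M.anc + 1))

variable (M : QCircuit κ m)

/-- The wires of the register. -/
def regWire : Fin (κ + M.anc) ↪ ProjWire M := Function.Embedding.inl.trans .inr

lemma regWire_apply (w : Fin (κ + M.anc)) : regWire M w = .inr (.inl w) := rfl

/-- The wires of the zero test. -/
def testWire : Fin (κ + M.anc + 1) ↪ ProjWire M := Function.Embedding.inr.trans .inr

lemma testWire_apply (w : Fin (κ + M.anc + 1)) : testWire M w = .inr (.inr w) := rfl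

lemma testWire_ne (w : Fin (κ + M.anc)) (j : Fin (κ + M.anc + 1)) : testWire M j ≠ regWire M w := by
  simp [regWire_apply, testWire_apply]

/-- Add the key to the register. -/
def addKey : List (Gate (ProjWire M)) :=
  cnots (fun i : Fin κ => (.inl (.inl i) : ProjWire M)) (fun i => .inr (.inl (i.castAdd M.anc)))
    fun _ _ => by simp

/-- Add the state to the output wires of the register. -/
def addState : List (Gate (ProjWire M)) :=
  cnots (fun i : Fin m => (.inl (.inr i) : ProjWire M)) (fun i => .inr (.inl (M.out i)))
    fun _ _ => by simp

/-- Add the output wires of the register to the state. -/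
def addOut : List (Gate (ProjWire M)) :=
  cnots (fun i : Fin m => (.inr (.inl (M.out i)) : ProjWire M)) (fun i => .inl (.inr i))
    fun _ _ => by simp

/-- The gates of `projCircuit` before the test. -/
def projPrep : List (Gate (ProjWire M)) :=
  addKey M ++ M.gates.map (Gate.map (regWire M)) ++ (addState M ++ addOut M ++ addState M) ++
    (inverseGates M.gates).map (Gate.map (regWire M))

/-- The test whether the register agrees with the key. -/
def projTest : List (Gate (ProjWire M)) :=
  addKey M ++ zeroTest (regWire M) (testWire M) (testWire_ne M)

/-- The numbering of the wires of `projCircuit`. -/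
def projEquiv : ProjWire M ≃ Fin ((κ + m) + ((κ + M.anc) + (κ + M.anc + 1))) :=
  (Equiv.sumCongr finSumFinEquiv finSumFinEquiv).trans finSumFinEquiv

/-- On a key `k` and a state: run `M` on a copy of the key, swap the output with the state, undo
`M` and accept if the register contains the key again. -/
def projCircuit : QCircuit (κ + m) 1 :=
  .ofWires (projEquiv M) (projPrep M ++ projTest M)
    ⟨fun _ => testWire M (Fin.last _), fun _ _ _ => Subsingleton.elim _ _⟩

/-- The assignments of the wires of `projCircuit`. -/
def assign (k : Bits κ) (p : Bits m) (w : Bits (κ + M.anc)) (c : Bits (κ + M.anc + 1)) :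
    ProjWire M → Bool := Sum.elim (Sum.elim k p) (Sum.elim w c)

lemma exists_assign (y : ProjWire M → Bool) : ∃ k p w c, y = assign M k p w c :=
  ⟨fun i => y (.inl (.inl i)), fun i => y (.inl (.inr i)), fun i => y (.inr (.inl i)),
    fun i => y (.inr (.inr i)), by funext i; rcases i with (i | i) | (i | i) <;> rfl⟩

lemma extend_assign_reg {n : ℕ} {g : Fin n → Fin (κ + M.anc)} (hg : g.Injective) (v : Bits n)
    (k : Bits κ) (p : Bits m) (w : Bits (κ + M.anc)) (c : Bits (κ + M.anc + 1)) :
    Function.extend (fun i => (.inr (.inl (g i)) : ProjWire M)) v (assign M k p w c) =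
      assign M k p (Function.extend g v w) c := by
  have hinj : Function.Injective fun i => (.inr (.inl (g i)) : ProjWire M) :=
    fun i j h => hg (by simpa using h)
  symm
  rw [eq_extend_iff hinj]
  refine ⟨funext fun i => hg.extend_apply _ _ _, fun x hx => ?_⟩
  rcases x with (i | i) | (i | i)
  · rfl
  · rfl
  · exact extend_off _ _ fun ⟨j, hj⟩ => hx ⟨j, by simp [hj]⟩
  · rfl

lemma gatesMatrix_addKey : ∃ F, gatesMatrix (addKey M) = funMatrix F ∧ F.Bijective ∧
    ∀ k p w c, F (assign M k p w c) = assign M k p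
      (Function.extend (Fin.castAdd M.anc) (fun i => xor (w (i.castAdd _)) (k i)) w) c := by
  have hinj : Function.Injective fun i : Fin κ => (.inr (.inl (i.castAdd M.anc)) : ProjWire M) :=
    fun i j h => by simpa using h
  refine ⟨_, gatesMatrix_cnots _ _ _ hinj, Function.Involutive.bijective fun z => ?_,
    fun k p w c => extend_assign_reg M (Fin.castAdd_injective _ _) _ _ _ _ _⟩
  refine ((eq_extend_iff hinj _ _ _).2 ⟨?_, fun x hx => ?_⟩).symm
  · funext i
    simp only [Function.comp_apply]
    rw [hinj.extend_apply, extend_off _ _ (by simp)]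
    simp
  · rw [extend_off _ _ hx]

/-- Three additions modulo 2 in alternating directions exchange two registers. -/
lemma gatesMatrix_swap : ∃ F, gatesMatrix (addState M ++ addOut M ++ addState M) = funMatrix F ∧
    ∀ k p w c, F (assign M k p w c) = assign M k (w ∘ M.out) (Function.extend M.out p w) c := by
  have h1 : Function.Injective fun i : Fin m => (.inr (.inl (M.out i)) : ProjWire M) :=
    fun i j h => by simpa using h
  have h2 : Function.Injective fun i : Fin m => (.inl (.inr i) : ProjWire M) :=
    fun i j h => by simpa using h
  refine ⟨_, by
    rw [gatesMatrix_append, gatesMatrix_append, addState, addOut, gatesMatrix_cnots _ _ _ h1,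
      gatesMatrix_cnots _ _ _ h2, funMatrix_mul, funMatrix_mul], fun k p w c => ?_⟩
  have h3 : ∀ v p w, Function.extend (fun i => (.inl (.inr i) : ProjWire M)) v (assign M k p w c) =
      assign M k v w c := by
    intro v p w
    symm
    rw [eq_extend_iff h2]
    refine ⟨rfl, fun x hx => ?_⟩
    rcases x with (i | i) | (i | i)
    · rfl
    · exact absurd ⟨i, rfl⟩ hx
    · rfl
    · rfl
  simp only [Function.comp_apply, extend_assign_reg M M.out.injective, h3]
  have hinj := M.out.injective
  congr 1
  · funext i
    simp only [assign, Sum.elim_inl, Sum.elim_inr, Function.comp_apply, hinj.extend_apply]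
    cases p i <;> simp
  · rw [eq_extend_iff hinj]
    refine ⟨?_, fun x hx => ?_⟩
    · funext i
      simp [assign, hinj.extend_apply]
    · rw [extend_off _ _ hx, extend_off _ _ hx]

lemma extend_append_zero (k : Bits κ) (v : Bits κ) :
    Function.extend (Fin.castAdd M.anc) v (Fin.append k fun _ => false) =
      Fin.append v fun _ => false := by
  symm
  rw [eq_extend_iff (Fin.castAdd_injective _ _)]
  refine ⟨funext fun i => by simp, fun w hw => ?_⟩
  induction w using Fin.addCases with
  | left i => exact absurd ⟨i, rfl⟩ hw
  | right i => simp

/-- The summation index `w` is the basis state of the register after `M` has run on the key; the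
swap then puts `p` on the output wires before `M` is undone. -/
lemma projPrep_apply (k : Bits κ) (p : Bits m) (y : ProjWire M → Bool) :
    gatesMatrix (projPrep M) y (assign M k p (fun _ => false) fun _ => false) =
      ∑ w, lift (regWire M) (gatesMatrix M.gates)ᴴ y
          (assign M k (w ∘ M.out) (Function.extend M.out p w) fun _ => false) *
        gatesMatrix M.gates w (Fin.append k fun _ => false) := by
  obtain ⟨F, hF, -, hF'⟩ := gatesMatrix_addKey M
  obtain ⟨G, hG, hG'⟩ := gatesMatrix_swap M
  -- The zero register splits into a zero key and zero ancillas, so adding the key produces exactly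
  -- the input of `M`.
  have h0 : (fun _ => false : Bits (κ + M.anc)) =
      Fin.append (fun _ => false : Bits κ) fun _ => false := by
    funext i
    induction i using Fin.addCases <;> simp
  rw [projPrep, gatesMatrix_append, gatesMatrix_append _ (_ ++ addState M),
    gatesMatrix_append (addKey M), gatesMatrix_map,
    gatesMatrix_map, gatesMatrix_inverseGates, hF, hG, ← Matrix.mul_assoc, ← Matrix.mul_assoc,
    mul_funMatrix_apply, hF', sum_lift_mul (regWire M).injective]
  refine Finset.sum_congr rfl fun w _ => ?_
  have h1 : ∀ v w, Function.extend (regWire M) w (assign M k p v fun _ => false) =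
      assign M k p w fun _ => false := by
    intro v w
    refine (extend_assign_reg M Function.injective_id w k p v _).trans ?_
    congr 1
    exact funext fun i => Function.injective_id.extend_apply _ _ i
  rw [h1, mul_funMatrix_apply, hG']
  congr 2
  rw [h0, extend_append_zero]
  funext i
  induction i using Fin.addCases <;> simp [assign, regWire_apply]

lemma lift_regWire_apply (U : Op (κ + M.anc)) (k k' : Bits κ) (p p' : Bits m)
    (w w' : Bits (κ + M.anc)) (c c' : Bits (κ + M.anc + 1)) :
    lift (regWire M) U (assign M k p w c) (assign M k' p' w' c') =
      if k = k' ∧ p = p' ∧ c = c' then U w w' else 0 := by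
  simp only [lift, of_apply]
  have : (∀ x ∉ Set.range (regWire M), assign M k p w c x = assign M k' p' w' c' x) ↔
      k = k' ∧ p = p' ∧ c = c' := by
    constructor
    · intro h
      refine ⟨funext fun i => h (.inl (.inl i)) ?_, funext fun i => h (.inl (.inr i)) ?_,
        funext fun i => h (.inr (.inr i)) ?_⟩ <;> simp [regWire_apply]
    · rintro ⟨rfl, rfl, rfl⟩ x hx
      rcases x with (i | i) | (i | i)
      · rfl
      · rfl
      · exact absurd ⟨i, rfl⟩ hx
      · rfl
  simp only [this]
  rfl

/-- The key serves only as a control and the test wires are not touched, so both keep their values.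
-/
lemma projPrep_support (k : Bits κ) (p : Bits m) (k' : Bits κ) (o : Bits m) (w : Bits (κ + M.anc))
    (c : Bits (κ + M.anc + 1)) (h : ¬ (k' = k ∧ c = fun _ => false)) :
    gatesMatrix (projPrep M) (assign M k' o w c) (assign M k p (fun _ => false) fun _ => false)
      = 0 := by
  rw [projPrep_apply]
  refine Finset.sum_eq_zero fun v _ => ?_
  rw [lift_regWire_apply, if_neg, zero_mul]
  tauto

/-- The heart of the construction. Undoing `M` with `p` on the output wires pairs the amplitude at
`w` with the conjugate amplitude at the string that agrees with `w` on the discarded wires. Summed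
over `w`, this is the entry of the partial trace. -/
lemma projPrep_key (k : Bits κ) (p o : Bits m) :
    gatesMatrix (projPrep M) (assign M k o (Fin.append k fun _ => false) fun _ => false)
      (assign M k p (fun _ => false) fun _ => false) = M.run (ket k) o p := by
  rw [projPrep_apply, M.run_ket_apply]
  refine Finset.sum_congr rfl fun w _ => ?_
  rw [lift_regWire_apply]
  simp only [true_and, and_true, eq_comm (a := o)]
  split_ifs
  · rw [conjTranspose_apply, mul_comm]
  · rw [zero_mul]

/-- Adding the key once more turns the comparison with the key into a test for zero. -/
lemma gatesMatrix_projTest : ∃ F, gatesMatrix (projTest M) = funMatrix F ∧ F.Bijective ∧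
    ∀ k p w, F (assign M k p w fun _ => false) (testWire M (Fin.last _)) = true ↔
      w = Fin.append k fun _ => false := by
  obtain ⟨F, hF, hFb, hF'⟩ := gatesMatrix_addKey M
  obtain ⟨G, hG, hGb, hG'⟩ := gatesMatrix_zeroTest (regWire M) (testWire M)
    (testWire_ne M)
  refine ⟨G ∘ F, by rw [projTest, gatesMatrix_append, hF, hG, funMatrix_mul], hGb.comp hFb,
    fun k p w => ?_⟩
  rw [Function.comp_apply, hF', hG' _ fun i => rfl]
  have hinj := Fin.castAdd_injective κ M.anc
  constructor
  · intro h
    funext i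
    have hi := h i
    induction i using Fin.addCases with
    | left i =>
      simp only [assign, regWire_apply, Sum.elim_inr, Sum.elim_inl] at hi
      rw [hinj.extend_apply] at hi
      simpa using hi
    | right i =>
      simp only [assign, regWire_apply, Sum.elim_inr, Sum.elim_inl] at hi
      rw [extend_off _ _ (by simp [Fin.ext_iff]; omega)] at hi
      simpa using hi
  · rintro rfl i
    simp only [assign, regWire_apply, Sum.elim_inr, Sum.elim_inl]
    rw [extend_append_zero]
    induction i using Fin.addCases <;> simp

/-- The acceptance probability of `projCircuit`. -/
lemma prob_projCircuit (k : Bits κ) (ρ : Op m) :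
    (projCircuit M).prob (tensor (ket k) ρ) (fun _ => true) =
      (M.run (ket k) * ρ * (M.run (ket k))ᴴ).trace.re := by
  obtain ⟨F, hF, hFb, hF'⟩ := gatesMatrix_projTest M
  set A : Matrix (ProjWire M → Bool) (Bits m) ℂ := gatesMatrix (projPrep M) *
    funMatrix fun p => assign M k p (fun _ => false) fun _ => false with hA
  have hin : ∀ p : Bits m, (Fin.append (Fin.append k p) fun _ => false) ∘ projEquiv M =
      assign M k p (fun _ => false) fun _ => false := by
    intro p
    funext x
    rcases x with (i | i) | (i | i) <;> simp [projEquiv, assign]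
  rw [QCircuit.prob, projCircuit, QCircuit.run_ofWires, ket_tensor]
  congr 1
  have hT : gatesMatrix (projPrep M ++ projTest M) *
      (funMatrix fun p : Bits (κ + m) => (Fin.append p fun _ => false) ∘ projEquiv M) *
      (funMatrix fun p : Bits m => (Fin.append k p : Bits (κ + m))) = funMatrix F * A := by
    rw [Matrix.mul_assoc, funMatrix_mul, gatesMatrix_append, hF, hA, Matrix.mul_assoc]
    congr 3
    funext p
    exact hin p
  have hT' : ∀ (T : Matrix (ProjWire M → Bool) (Bits (κ + m)) ℂ) (J : Matrix (Bits (κ + m)) (Bits m) ℂ),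
      T * (J * ρ * Jᴴ) * Tᴴ = (T * J) * ρ * (T * J)ᴴ := by
    intro T J
    simp only [conjTranspose_mul, Matrix.mul_assoc]
  rw [hT', hT, conjTranspose_mul]
  have hT2 : funMatrix F * A * ρ * (Aᴴ * (funMatrix F)ᴴ) =
      funMatrix F * (A * ρ * Aᴴ) * (funMatrix F)ᴴ := by simp only [Matrix.mul_assoc]
  rw [hT2]
  have hout : ∀ x : ProjWire M → Bool,
      (x ∘ (⟨fun _ => testWire M (Fin.last _), fun _ _ _ => Subsingleton.elim _ _⟩ :
        Fin 1 ↪ ProjWire M) = fun _ => true) ↔ x (testWire M (Fin.last _)) = true := by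
    intro x
    exact ⟨fun h => congrFun h 0, fun h => funext fun _ => h⟩
  -- The test permutes the basis states, so the sum over final states becomes a sum over the states
  -- before the test.
  rw [← (Equiv.ofBijective F hFb).sum_comp, trace]
  symm
  refine Fintype.sum_of_injective
    (fun o => assign M k o (Fin.append k fun _ => false) fun _ => false) ?_ _ _ ?_ ?_
  · intro o o' h
    funext i
    exact congrFun h (.inl (.inr i))
  · intro y hy
    rw [Equiv.ofBijective_apply]
    split_ifs with h
    · have h' := (hout _).1 h
      rw [← (eq_extend_iff (Function.Embedding.injective _) _ _ _).2 ⟨h, fun _ _ => rfl⟩,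
        funMatrix_conj_apply hFb.1]
      obtain ⟨k', o, w, c, rfl⟩ := exists_assign M y
      -- A nonzero amplitude would force the key `k` and zero test wires; then acceptance puts the
      -- key back in the register, and the assignment is in the excluded range.
      have hz : ∀ p, A (assign M k' o w c) p = 0 := by
        intro p
        rw [hA, mul_funMatrix_apply]
        apply projPrep_support
        rintro ⟨rfl, rfl⟩
        rw [hF'] at h'
        exact hy ⟨o, by rw [h']⟩
      rw [mul_apply]
      refine Finset.sum_eq_zero fun q _ => ?_
      rw [conjTranspose_apply, hz, star_zero, mul_zero]
    · rfl
  · intro o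
    rw [Equiv.ofBijective_apply]
    have h : _ = true := (hF' k o _).2 rfl
    rw [if_pos ((hout _).2 h),
      ← (eq_extend_iff (Function.Embedding.injective _) _ _ _).2 ⟨(hout _).2 h, fun _ _ => rfl⟩,
      funMatrix_conj_apply hFb.1]
    have hA' : ∀ p, A (assign M k o (Fin.append k fun _ => false) fun _ => false) p =
        M.run (ket k) o p := by
      intro p
      rw [hA, mul_funMatrix_apply, projPrep_key]
    simp only [diag_apply, mul_apply, conjTranspose_apply, hA']

end Proj

end QCrypto

namespace QCrypto

open Matrix
open scoped ComplexOrder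

/-! ### Many copies of the state of a key that a circuit finds -/

section Clone
variable {a κ m : ℕ} (l : ℕ) (A : QCircuit a κ) (M : QCircuit κ m)

/-- The wires of `cloneCircuit`: those of `A` and `l` registers for `M`. -/
abbrev CloneWire : Type := Fin (a + A.anc) ⊕ (Fin l × Fin (κ + M.anc))

/-- The wires of `A`. -/
def firstWire : Fin (a + A.anc) ↪ CloneWire l A M := .inl

/-- The wires of the register `j`. -/
def blockWire (j : Fin l) : Fin (κ + M.anc) ↪ CloneWire l A M :=
  ⟨fun w => .inr (j, w), fun _ _ h => by simpa using h⟩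

/-- Copy the key to the register `j`. -/
def sendKey (j : Fin l) : List (Gate (CloneWire l A M)) :=
  cnots (fun i : Fin κ => (.inl (A.out i) : CloneWire l A M)) (fun i => .inr (j, i.castAdd M.anc))
    fun _ _ => by simp

/-- The gates of `cloneCircuit`. -/
def cloneGates : List (Gate (CloneWire l A M)) :=
  A.gates.map (Gate.map (firstWire l A M)) ++ (List.finRange l).flatMap (sendKey l A M) ++
    (List.finRange l).flatMap fun j => M.gates.map (Gate.map (blockWire l A M j))

/-- The numbering of the wires of `cloneCircuit`. -/
def cloneEquiv : CloneWire l A M ≃ Fin (a + (A.anc + l * (κ + M.anc))) :=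
  ((Equiv.sumCongr (Equiv.refl _) finProdFinEquiv).trans finSumFinEquiv).trans
    (finCongr (Nat.add_assoc _ _ _))

/-- The output wires of `cloneCircuit`. -/
def cloneOut : Fin (l * m) ↪ CloneWire l A M :=
  ⟨fun q => .inr ((finProdFinEquiv.symm q).1, M.out (finProdFinEquiv.symm q).2), fun p q h => by
    simp only [Sum.inr.injEq, Prod.mk.injEq, M.out.injective.eq_iff] at h
    exact finProdFinEquiv.symm.injective (Prod.ext h.1 h.2)⟩

lemma cloneOut_apply (j : Fin l) (i : Fin m) :
    cloneOut l A M (finProdFinEquiv (j, i)) = .inr (j, M.out i) := by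
  change Sum.inr ((finProdFinEquiv.symm _).1, M.out (finProdFinEquiv.symm _).2) = _
  rw [Equiv.symm_apply_apply]

/-- Run `A` to find a key, and run `M` on `l` copies of it. -/
def cloneCircuit : QCircuit a (l * m) :=
  .ofWires (cloneEquiv l A M) (cloneGates l A M) (cloneOut l A M)

/-- The assignments of the wires of `cloneCircuit`. -/
def cloneAssign (x : Bits (a + A.anc)) (b : Fin l → Bits (κ + M.anc)) : CloneWire l A M → Bool :=
  Sum.elim x fun q => b q.1 q.2

/-- The assignments of the wires of `cloneCircuit` are given by their parts. -/
def cloneAssignEquiv :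
    Bits (a + A.anc) × (Fin l → Bits (κ + M.anc)) ≃ (CloneWire l A M → Bool) where
  toFun q := cloneAssign l A M q.1 q.2
  invFun y := (fun i => y (.inl i), fun j w => y (.inr (j, w)))
  left_inv _ := rfl
  right_inv y := by funext i; rcases i with i | i <;> rfl

lemma extend_blockWire (j : Fin l) {n : ℕ} {g : Fin n → Fin (κ + M.anc)} (hg : g.Injective)
    (v : Bits n) (x : Bits (a + A.anc)) (b : Fin l → Bits (κ + M.anc)) :
    Function.extend (fun i => (.inr (j, g i) : CloneWire l A M)) v (cloneAssign l A M x b) =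
      cloneAssign l A M x (Function.update b j (Function.extend g v (b j))) := by
  have hinj : Function.Injective fun i => (.inr (j, g i) : CloneWire l A M) :=
    fun i j h => hg (by simpa using h)
  symm
  rw [eq_extend_iff hinj]
  refine ⟨funext fun i => by simp [cloneAssign, hg.extend_apply], fun w hw => ?_⟩
  rcases w with i | ⟨i, w⟩
  · rfl
  · simp only [cloneAssign, Sum.elim_inr]
    by_cases hi : i = j
    · subst hi
      rw [Function.update_self, extend_off]
      rintro ⟨q, rfl⟩
      exact hw ⟨q, rfl⟩
    · rw [Function.update_of_ne hi]

lemma gatesMatrix_sendKeys (L : List (Fin l)) (hL : L.Nodup) :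
    ∃ F, gatesMatrix (L.flatMap (sendKey l A M)) = funMatrix F ∧
      ∀ x b, F (cloneAssign l A M x b) = cloneAssign l A M x fun j => if j ∈ L then
        Function.extend (Fin.castAdd M.anc) (fun i => xor (b j (i.castAdd _)) (x (A.out i))) (b j)
        else b j := by
  induction L with
  | nil => exact ⟨fun z => z, funMatrix_id.symm, by simp⟩
  | cons j L ih =>
    rw [List.nodup_cons] at hL
    obtain ⟨F, hF, hF'⟩ := ih hL.2
    have hinj : Function.Injective
        fun i : Fin κ => (.inr (j, i.castAdd M.anc) : CloneWire l A M) :=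
      fun i j h => by simpa using h
    refine ⟨_, by rw [List.flatMap_cons, gatesMatrix_append, hF, sendKey,
      gatesMatrix_cnots _ _ _ hinj, funMatrix_mul], fun x b => ?_⟩
    rw [Function.comp_apply, extend_blockWire l A M j (Fin.castAdd_injective _ _), hF']
    congr 1
    funext i
    by_cases hi : i = j
    · subst hi
      simp [hL.1, cloneAssign]
    · simp [hi]

/-- The copies of `M` act on disjoint registers, so amplitudes multiply; registers outside `L` are
unchanged. -/
lemma gatesMatrix_blocks (L : List (Fin l)) (hL : L.Nodup) (x x' : Bits (a + A.anc))
    (b b' : Fin l → Bits (κ + M.anc)) :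
    gatesMatrix (L.flatMap fun j => M.gates.map (Gate.map (blockWire l A M j)))
        (cloneAssign l A M x b) (cloneAssign l A M x' b') =
      if x = x' ∧ ∀ j ∉ L, b j = b' j then
        (L.map fun j => gatesMatrix M.gates (b j) (b' j)).prod else 0 := by
  induction L generalizing b' with
  | nil =>
    have : cloneAssign l A M x b = cloneAssign l A M x' b' ↔ x = x' ∧ b = b' := by
      rw [← Prod.mk.injEq]
      exact (cloneAssignEquiv l A M).injective.eq_iff (a := (x, b)) (b := (x', b'))
    simp [gatesMatrix_nil, one_apply, this, funext_iff (f := b)]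
  | cons j L ih =>
    rw [List.nodup_cons] at hL
    rw [List.flatMap_cons, gatesMatrix_append, gatesMatrix_map,
      sum_lift_mul (blockWire l A M j).injective]
    have h1 : ∀ v, Function.extend (blockWire l A M j) v (cloneAssign l A M x' b') =
        cloneAssign l A M x' (Function.update b' j v) := fun v => by
      refine (extend_blockWire l A M j Function.injective_id v x' b').trans ?_
      congr 2
      exact funext fun i => Function.injective_id.extend_apply _ _ i
    have h2 : ∀ v, (x = x' ∧ ∀ i ∉ L, b i = Function.update b' j v i) ↔
        v = b j ∧ x = x' ∧ ∀ i ∉ j :: L, b i = b' i := by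
      intro v
      constructor
      · rintro ⟨hx, h⟩
        refine ⟨by simpa using (h j hL.1).symm, hx, fun i hi => ?_⟩
        rw [List.mem_cons, not_or] at hi
        rw [h i hi.2, Function.update_of_ne hi.1]
      · rintro ⟨rfl, hx, h⟩
        refine ⟨hx, fun i hi => ?_⟩
        by_cases hij : i = j
        · subst hij; simp
        · rw [Function.update_of_ne hij]
          exact h i (by simp [hij, hi])
    have h3 : ∀ v, (L.map fun i => gatesMatrix M.gates (b i) (Function.update b' j v i)) =
        L.map fun i => gatesMatrix M.gates (b i) (b' i) := fun v =>
      List.map_congr_left fun i hi => by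
        rw [Function.update_of_ne]; rintro rfl; exact hL.1 hi
    simp only [h1, ih hL.2, h2, h3, ite_and, ite_mul, zero_mul, Finset.sum_ite_eq',
      Finset.mem_univ, if_true, List.map_cons, List.prod_cons]
    rw [mul_comm]
    rfl

/-- The amplitudes of `cloneCircuit`. -/
lemma cloneGates_apply (p : Bits a) (x : Bits (a + A.anc)) (b : Fin l → Bits (κ + M.anc)) :
    (gatesMatrix (cloneGates l A M) *
        funMatrix fun p : Bits a => (Fin.append p fun _ => false) ∘ cloneEquiv l A M)
      (cloneAssign l A M x b) p =
      A.iso x p * ∏ j, gatesMatrix M.gates (b j) (Fin.append (x ∘ A.out) fun _ => false) := by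
  obtain ⟨F, hF, hF'⟩ := gatesMatrix_sendKeys l A M (List.finRange l) (List.nodup_finRange l)
  have hin : (Fin.append p fun _ => false) ∘ cloneEquiv l A M =
      cloneAssign l A M (Fin.append p fun _ => false) fun _ _ => false := by
    funext x
    rcases x with i | ⟨j, w⟩
    · induction i using Fin.addCases with
      | left i =>
        have : cloneEquiv l A M (.inl (i.castAdd _)) = i.castAdd _ := by
          ext; simp [cloneEquiv]
        simp [cloneAssign, this]
      | right i =>
        have : cloneEquiv l A M (.inl (i.natAdd _)) = (i.castAdd _).natAdd _ := by
          ext; simp [cloneEquiv]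
        simp [cloneAssign, this]
    · have : cloneEquiv l A M (.inr (j, w)) = ((finProdFinEquiv (j, w)).natAdd _).natAdd _ := by
        ext; simp [cloneEquiv, Nat.add_assoc]
      simp [cloneAssign, this]
  have hext : ∀ v x', Function.extend (firstWire l A M) v
      (cloneAssign l A M x' fun _ _ => false) = cloneAssign l A M v fun _ _ => false := by
    intro v x'
    symm
    rw [eq_extend_iff (firstWire l A M).injective]
    refine ⟨rfl, fun w hw => ?_⟩
    rcases w with i | i
    · exact absurd ⟨i, rfl⟩ hw
    · rfl
  have hkey : ∀ v : Bits (a + A.anc), Function.extend (Fin.castAdd M.anc)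
      (fun i => xor false (v (A.out i))) (fun _ => false) =
      (Fin.append (v ∘ A.out) fun _ => false : Bits (κ + M.anc)) := by
    intro v
    symm
    rw [eq_extend_iff (Fin.castAdd_injective _ _)]
    refine ⟨funext fun i => by simp, fun w hw => ?_⟩
    induction w using Fin.addCases with
    | left i => exact absurd ⟨i, rfl⟩ hw
    | right i => simp
  rw [mul_funMatrix_apply, hin, cloneGates, gatesMatrix_append, gatesMatrix_append, hF,
    gatesMatrix_map, ← Matrix.mul_assoc, sum_lift_mul (firstWire l A M).injective]
  simp only [hext, mul_funMatrix_apply, hF', List.mem_finRange, if_true,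
    gatesMatrix_blocks l A M _ (List.nodup_finRange l), not_true_eq_false, false_implies,
    implies_true, and_true, ite_mul, zero_mul, Finset.sum_ite_eq, Finset.mem_univ, hkey]
  rw [← Fin.prod_univ_def, mul_comm, QCircuit.iso, mul_funMatrix_apply]
  rfl

/-- The state that `cloneCircuit` outputs. -/
lemma run_cloneCircuit (ρ : Op a) :
    (cloneCircuit l A M).run ρ = ∑ k, A.run ρ k k • copies l (M.run (ket k)) := by
  ext y y'
  rw [cloneCircuit, QCircuit.run_ofWires, ← (cloneAssignEquiv l A M).sum_comp,
    Fintype.sum_prod_type]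
  set T := gatesMatrix (cloneGates l A M) *
    funMatrix fun p : Bits a => (Fin.append p fun _ => false) ∘ cloneEquiv l A M with hT
  have h1 : ∀ x b, cloneAssign l A M x b ∘ cloneOut l A M = y ↔
      ∀ j, b j ∘ M.out = block y j := by
    intro x b
    constructor
    · rintro rfl j
      funext i
      simp [block, cloneOut_apply, cloneAssign]
    · intro h
      funext q
      obtain ⟨⟨j, i⟩, rfl⟩ := finProdFinEquiv.surjective q
      rw [Function.comp_apply, cloneOut_apply]
      exact congrFun (h j) i
  have h2 : ∀ x b, Function.extend (cloneOut l A M) y' (cloneAssign l A M x b) =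
      cloneAssign l A M x fun j => Function.extend M.out (block y' j) (b j) := by
    intro x b
    symm
    rw [eq_extend_iff (cloneOut l A M).injective]
    refine ⟨?_, fun w hw => ?_⟩
    · funext q
      obtain ⟨⟨j, i⟩, rfl⟩ := finProdFinEquiv.surjective q
      rw [Function.comp_apply, cloneOut_apply]
      exact M.out.injective.extend_apply (block y' j) (b j) i
    · rcases w with i | ⟨j, i⟩
      · rfl
      · refine extend_off _ _ ?_
        rintro ⟨q, rfl⟩
        exact hw ⟨finProdFinEquiv (j, q), cloneOut_apply l A M j q⟩
  -- All the wires of `A` are discarded, so only entries with the same `x` on both sides occur. This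
  -- dephases the key: the output is a classical mixture over the keys.
  have h3 : ∀ x b b', (T * ρ * Tᴴ) (cloneAssign l A M x b) (cloneAssign l A M x b') =
      (A.iso * ρ * A.isoᴴ) x x * ∏ j, (gatesMatrix M.gates (b j)
        (Fin.append (x ∘ A.out) fun _ => false) *
        star (gatesMatrix M.gates (b' j) (Fin.append (x ∘ A.out) fun _ => false))) := by
    intro x b b'
    rw [mul_apply, mul_apply, Finset.sum_mul]
    refine Finset.sum_congr rfl fun q _ => ?_
    rw [mul_apply, mul_apply, conjTranspose_apply, conjTranspose_apply, hT, cloneGates_apply,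
      star_mul', star_prod, Finset.prod_mul_distrib]
    simp only [cloneGates_apply]
    rw [Finset.sum_mul, Finset.sum_mul, Finset.sum_mul]
    refine Finset.sum_congr rfl fun p _ => ?_
    ring
  have h4 : ∀ x : Bits (a + A.anc), (∑ b : Fin l → Bits (κ + M.anc),
      if cloneAssign l A M x b ∘ cloneOut l A M = y then (T * ρ * Tᴴ) (cloneAssign l A M x b)
        (Function.extend (cloneOut l A M) y' (cloneAssign l A M x b)) else 0) =
      (A.iso * ρ * A.isoᴴ) x x * copies l (M.run (ket (x ∘ A.out))) y y' := by
    intro x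
    simp only [copies, of_apply, M.run_ket_apply, Finset.prod_univ_sum, Fintype.piFinset_univ,
      Finset.mul_sum]
    refine Finset.sum_congr rfl fun b _ => ?_
    rw [h2, h3, Finset.prod_ite_zero]
    simp only [h1, Finset.mem_univ, true_implies]
    split_ifs <;> simp
  refine (Finset.sum_congr rfl fun x _ => h4 x).trans ?_
  rw [Matrix.sum_apply]
  simp only [Matrix.smul_apply, smul_eq_mul, A.run_eq, reduceTo_diag, Finset.sum_mul, ite_mul, zero_mul]
  rw [Finset.sum_comm]
  refine Finset.sum_congr rfl fun x _ => ?_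
  simp

end Clone

end QCrypto

namespace QCrypto

open Enc

/-! ### Descriptions of circuits -/

/-- Descriptions of circuits: the numbers of input and of ancilla wires, the gates (as lists of a
kind and of wires) and the output wires. -/
abbrev RawCircuit : Type := ℕ × ℕ × List (List ℕ) × List ℕ × Unit

/-- The description of a gate on wires that are numbered by `c`. -/
def Gate.code {W : Type} (c : W → ℕ) : Gate W → List ℕ
  | .x a => [0, c a]
  | .h a => [1, c a]
  | .t a => [2, c a]
  | .tdg a => [3, c a]
  | .cnot a b _ => [4, c a, c b]
  | .ccx a₁ a₂ b _ _ _ => [5, c a₁, c a₂, c b]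

/-- The description of a circuit. -/
def QCircuit.raw {a b : ℕ} (C : QCircuit a b) : RawCircuit :=
  (a, C.anc, C.gates.map (Gate.code Fin.val), List.ofFn fun i => (C.out i : ℕ), ())

lemma enc_raw {a b : ℕ} (C : QCircuit a b) : enc C.raw = C.encode := by
  have h1 : (enc (C.gates.map (Gate.code Fin.val))) =
      .ofList (C.gates.map Gate.encode) := by
    change Data.ofList ((C.gates.map _).map _) = _
    rw [List.map_map]
    congr 2
    funext g
    cases g <;> rfl
  have h2 : (enc (List.ofFn fun i => (C.out i : ℕ))) =
      .ofList (List.ofFn fun i => .ofNat (C.out i)) := by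
    change Data.ofList ((List.ofFn _).map _) = _
    rw [List.map_ofFn]
    rfl
  simp only [QCircuit.raw, enc_pair, h1, h2]
  rfl

lemma isQPT_iff {a b : ℕ → ℕ} (A : QAlgorithm a b) : IsQPT A ↔ PolyTime fun n => (A n).raw := by
  rw [← polyTimeGenerated_iff]
  simp only [enc_raw]
  rfl

lemma Gate.code_map {V W : Type} (f : V ↪ W) (c : W → ℕ) (g : Gate V) :
    (g.map f).code c = g.code fun v => c (f v) := by
  cases g <;> rfl

/-- Shift the wires in the description of a gate. -/
def shiftCode (s : ℕ) (g : List ℕ) : List ℕ := g.headD 0 :: g.tail.map fun w => s + w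

lemma Gate.code_shift {W : Type} (s : ℕ) (c : W → ℕ) (g : Gate W) :
    (g.code fun w => s + c w) = shiftCode s (g.code c) := by
  cases g <;> rfl

lemma raw_ofWires {a b anc : ℕ} {W : Type} (e : W ≃ Fin (a + anc)) (l : List (Gate W))
    (o : Fin b ↪ W) : (QCircuit.ofWires e l o).raw =
      (a, anc, l.map (Gate.code fun w => (e w : ℕ)), List.ofFn fun i => (e (o i) : ℕ), ()) := by
  have : (l.map (Gate.map e.toEmbedding)).map (Gate.code Fin.val) =
      l.map (Gate.code fun w => (e w : ℕ)) := by
    rw [List.map_map]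
    exact List.map_congr_left fun g _ => Gate.code_map _ _ g
  rw [← this]
  rfl

lemma map_finRange {α : Type*} {n : ℕ} (f : Fin n → α) (g : ℕ → α) (h : ∀ i, f i = g i) :
    (List.finRange n).map f = (List.range n).map g := by
  rw [← List.map_coe_finRange_eq_range, List.map_map]
  exact List.map_congr_left fun i _ => h i

lemma flatMap_finRange {α : Type*} {n : ℕ} (f : Fin n → List α) (g : ℕ → List α)
    (h : ∀ i, f i = g i) : (List.finRange n).flatMap f = (List.range n).flatMap g := by
  rw [← List.map_coe_finRange_eq_range, List.flatMap_map]
  exact List.flatMap_congr fun i _ => h i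

lemma getD_ofFn {n : ℕ} (f : Fin n → ℕ) (i : Fin n) : (List.ofFn f).getD i 0 = f i := by
  rw [List.getD_eq_getElem _ _ (by simp)]
  simp

lemma map_code_cnots {n : ℕ} {W : Type} (c : W → ℕ) (src dst : Fin n → W)
    (hne : ∀ i j, src i ≠ dst j) (s d : ℕ → ℕ) (hs : ∀ i, c (src i) = s i)
    (hd : ∀ i, c (dst i) = d i) :
    (cnots src dst hne).map (Gate.code c) = (List.range n).map fun i => [4, s i, d i] := by
  rw [cnots, List.map_map]
  refine map_finRange _ _ fun i => ?_
  rw [← hs, ← hd]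
  rfl

lemma map_code_gates {n : ℕ} {W : Type} (f : Fin n ↪ W) (c : W → ℕ) (s : ℕ)
    (h : ∀ i, c (f i) = s + i) (l : List (Gate (Fin n))) :
    (l.map (Gate.map f)).map (Gate.code c) =
      (l.map (Gate.code Fin.val)).map (shiftCode s) := by
  rw [List.map_map, List.map_map]
  refine List.map_congr_left fun g _ => ?_
  rw [Function.comp_apply, Function.comp_apply, ← Gate.code_shift, Gate.code_map]
  simp only [h]

/-- The description of `projCircuit`, for a circuit with `κ` input wires, `N` wires, gates `g` and
output wires `o`. -/
def projRaw (κ N m : ℕ) (g : List (List ℕ)) (o : List ℕ) : RawCircuit :=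
  (κ + m, N + (N + 1),
    ((List.range κ).map fun i => [4, i, κ + m + i]) ++ g.map (shiftCode (κ + m)) ++
    (((List.range m).map fun i => [4, κ + i, κ + m + o.getD i 0]) ++
      ((List.range m).map fun i => [4, κ + m + o.getD i 0, κ + i]) ++
      ((List.range m).map fun i => [4, κ + i, κ + m + o.getD i 0])) ++
    ((g.reverse.flatMap fun g => [g, g, g, g, g, g, g]).map (shiftCode (κ + m))) ++
    (((List.range κ).map fun i => [4, i, κ + m + i]) ++
      [0, κ + m + N] :: (List.range N).flatMap fun w => [[0, κ + m + w],
        [5, κ + m + N + w, κ + m + w, κ + m + N + (w + 1)]]),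
    [κ + m + N + N], ())

section
variable {κ m : ℕ} (M : QCircuit κ m)

lemma projEquiv_val (x : ProjWire M) : (projEquiv M x : ℕ) =
    Sum.elim (Sum.elim (fun i : Fin κ => (i : ℕ)) fun i : Fin m => κ + i)
      (Sum.elim (fun i : Fin (κ + M.anc) => κ + m + i)
        fun i : Fin (κ + M.anc + 1) => κ + m + (κ + M.anc) + i) x := by
  rcases x with (i | i) | (i | i) <;> simp [projEquiv, Nat.add_assoc]

/-- Only the description of `M` enters the right-hand side, as uniformity requires. -/
lemma raw_projCircuit : (projCircuit M).raw =
    projRaw κ (κ + M.anc) m (M.gates.map (Gate.code Fin.val))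
      (List.ofFn fun i => (M.out i : ℕ)) := by
  set c : ProjWire M → ℕ := fun x => (projEquiv M x : ℕ) with hc
  have hc' : ∀ x, c x = _ := projEquiv_val M
  have h1 : (addKey M).map (Gate.code c) = (List.range κ).map fun i => [4, i, κ + m + i] :=
    map_code_cnots _ _ _ _ _ _ (by simp [hc']) (by simp [hc'])
  have h2 : (addState M).map (Gate.code c) = (List.range m).map fun i =>
      [4, κ + i, κ + m + (List.ofFn fun i => (M.out i : ℕ)).getD i 0] :=
    map_code_cnots _ _ _ _ _ (fun i => κ + m + (List.ofFn fun i => (M.out i : ℕ)).getD i 0)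
      (by simp [hc']) (fun i => by simp only [getD_ofFn, hc']; rfl)
  have h3 : (addOut M).map (Gate.code c) = (List.range m).map fun i =>
      [4, κ + m + (List.ofFn fun i => (M.out i : ℕ)).getD i 0, κ + i] :=
    map_code_cnots _ _ _ _ (fun i => κ + m + (List.ofFn fun i => (M.out i : ℕ)).getD i 0) _
      (fun i => by simp only [getD_ofFn, hc']; rfl) (by simp [hc'])
  have h4 : ∀ l : List (Gate (Fin (κ + M.anc))),
      (l.map (Gate.map (regWire M))).map (Gate.code c) =
        (l.map (Gate.code Fin.val)).map (shiftCode (κ + m)) :=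
    map_code_gates _ _ _ (by simp [hc', regWire_apply])
  have h5 : (inverseGates M.gates).map (Gate.code Fin.val) =
      (M.gates.map (Gate.code Fin.val)).reverse.flatMap
        fun g => [g, g, g, g, g, g, g] := by
    rw [inverseGates, List.map_flatMap, ← List.map_reverse, List.flatMap_map]
    rfl
  have h6 : ∀ h, (zeroTest (regWire M) (testWire M) h).map (Gate.code c) =
      [0, κ + m + (κ + M.anc)] :: (List.range (κ + M.anc)).flatMap fun w => [[0, κ + m + w],
        [5, κ + m + (κ + M.anc) + w, κ + m + w, κ + m + (κ + M.anc) + (w + 1)]] := by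
    intro h
    rw [zeroTest, List.map_cons, List.map_flatMap]
    refine congrArg₂ List.cons ?_ ?_
    · simp [Gate.code, hc', testWire_apply]
    · exact flatMap_finRange _ _ fun i => by
        simp [Gate.code, hc', testWire_apply, regWire_apply]
  rw [projCircuit, raw_ofWires, projRaw]
  congr 3
  · rw [← hc, projPrep, projTest]
    simp only [List.map_append, h1, h2, h3, h4, h5]
    rw [h6]
  · change (List.ofFn fun _ : Fin 1 => c (testWire M (Fin.last _)), ()) = _
    simp [hc', testWire_apply]

end

/-- The description of `cloneCircuit`, for circuits with wires, gates and output wires as given. -/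
def cloneRaw (l a κ ancA N : ℕ) (gA : List (List ℕ)) (oA : List ℕ) (g : List (List ℕ))
    (o : List ℕ) : RawCircuit :=
  (a, ancA + l * N,
    gA ++ ((List.range l).flatMap fun j => (List.range κ).map fun i =>
      [4, oA.getD i 0, a + ancA + N * j + i]) ++
    (List.range l).flatMap (fun j => g.map (shiftCode (a + ancA + N * j))),
    (List.range l).flatMap (fun j => o.map fun w => a + ancA + N * j + w), ())

section
variable {a κ m : ℕ} (l : ℕ) (A : QCircuit a κ) (M : QCircuit κ m)

lemma cloneEquiv_val (x : CloneWire l A M) : (cloneEquiv l A M x : ℕ) =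
    Sum.elim (fun i : Fin (a + A.anc) => (i : ℕ))
      (fun q : Fin l × Fin (κ + M.anc) => a + A.anc + (κ + M.anc) * (q.1 : ℕ) + (q.2 : ℕ)) x := by
  rcases x with i | ⟨j, w⟩
  · simp [cloneEquiv]
  · simp [cloneEquiv]
    ring

lemma raw_cloneCircuit : (cloneCircuit l A M).raw =
    cloneRaw l a κ A.anc (κ + M.anc) (A.gates.map (Gate.code Fin.val))
      (List.ofFn fun i => (A.out i : ℕ)) (M.gates.map (Gate.code Fin.val))
      (List.ofFn fun i => (M.out i : ℕ)) := by
  set c : CloneWire l A M → ℕ := fun x => (cloneEquiv l A M x : ℕ) with hc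
  have hc' : ∀ x, c x = _ := cloneEquiv_val l A M
  rw [cloneCircuit, raw_ofWires, cloneRaw]
  congr 3
  · rw [← hc, cloneGates, List.map_append, List.map_append, List.map_flatMap, List.map_flatMap]
    refine congrArg₂ (· ++ ·) (congrArg₂ (· ++ ·) ?_ ?_) ?_
    · rw [List.map_map]
      refine List.map_congr_left fun g _ => ?_
      rw [Function.comp_apply, Gate.code_map]
      simp [hc', firstWire]
    · refine flatMap_finRange _ _ fun j => ?_
      exact map_code_cnots _ _ _ _ (fun i => (List.ofFn fun i => (A.out i : ℕ)).getD i 0)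
        (fun i => a + A.anc + (κ + M.anc) * (j : ℕ) + i)
        (fun i => by simp only [getD_ofFn, hc']; rfl) (by simp [hc'])
    · refine flatMap_finRange _ _ fun j => ?_
      exact map_code_gates _ _ _ (fun _ => hc' _) _
  · congr 1
    rw [List.ofFn_mul, List.ofFn_eq_map, ← List.flatMap_def]
    refine flatMap_finRange _ _ fun j => ?_
    rw [List.map_ofFn]
    congr 1
    funext i
    have : (⟨j * m + i, by
        have := finProdFinEquiv (j, i) |>.2
        simp only [finProdFinEquiv_apply_val] at this
        linarith [mul_comm m j]⟩ : Fin (l * m)) = finProdFinEquiv (j, i) := by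
      ext; simp [mul_comm, add_comm]
    change c (cloneOut l A M ⟨j * m + i, _⟩) = _
    rw [this, cloneOut_apply, hc']
    rfl

end

/-! ### The descriptions are computed in polynomial time -/

namespace PolyTime

variable {α : Type} [Enc α]

lemma shiftCode {s : α → ℕ} {g : α → List ℕ} (hs : PolyTime s) (hg : PolyTime g) :
    PolyTime fun x => shiftCode (s x) (g x) :=
  hg.headD.cons (hg.tail.map (g := fun x w => s x + w) ((hs.comp fst').add snd'))

lemma projRaw {κ N m : α → ℕ} {g : α → List (List ℕ)} {o : α → List ℕ} (hκ : PolyTime κ)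
    (hN : PolyTime N) (hm : PolyTime m) (hg : PolyTime g) (ho : PolyTime o) :
    PolyTime fun x => projRaw (κ x) (N x) (m x) (g x) (o x) := by
  unfold QCrypto.projRaw
  -- Each alternative is a closure property. Those with `comp fst'` carry a parameter under the
  -- bound variable of a `map` or `flatMap`.
  repeat first
    | exact natConst _
    | exact id
    | exact nil
    | exact unit
    | assumption
    | refine PolyTime.shiftCode ?_ ?_
    | refine pair ?_ ?_
    | refine add ?_ ?_
    | refine append ?_ ?_
    | refine cons ?_ ?_
    | refine reverse ?_
    | refine range ?_
    | refine getD ?_ ?_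
    | refine map ?_ ?_
    | refine flatMap ?_ ?_
    | exact hκ.comp fst'
    | exact hN.comp fst'
    | exact hm.comp fst'
    | exact hg.comp fst'
    | exact ho.comp fst'
    | exact snd'

lemma cloneRaw {l a κ ancA N : α → ℕ} {gA g : α → List (List ℕ)} {oA o : α → List ℕ}
    (hl : PolyTime l) (ha : PolyTime a) (hκ : PolyTime κ) (hancA : PolyTime ancA)
    (hN : PolyTime N) (hgA : PolyTime gA) (hoA : PolyTime oA) (hg : PolyTime g)
    (ho : PolyTime o) : PolyTime fun x =>
      cloneRaw (l x) (a x) (κ x) (ancA x) (N x) (gA x) (oA x) (g x) (o x) := by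
  unfold QCrypto.cloneRaw
  repeat first
    | exact natConst _
    | exact id
    | exact nil
    | exact unit
    | assumption
    | refine PolyTime.shiftCode ?_ ?_
    | refine pair ?_ ?_
    | refine add ?_ ?_
    | refine mul ?_ ?_
    | refine append ?_ ?_
    | refine cons ?_ ?_
    | refine range ?_
    | refine getD ?_ ?_
    | refine map ?_ ?_
    | refine flatMap ?_ ?_
    | exact hκ.comp fst'
    | exact hN.comp fst'
    | exact ha.comp fst'
    | exact hancA.comp fst'
    | exact hoA.comp fst'
    | exact hg.comp fst'
    | exact ho.comp fst'
    | exact (ha.comp fst').comp fst'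
    | exact (hN.comp fst').comp fst'
    | exact (hancA.comp fst').comp fst'
    | exact (hoA.comp fst').comp fst'
    | exact snd'
    | exact snd'.comp fst'

end PolyTime

end QCrypto

namespace QCrypto

open Matrix
open scoped ComplexOrder

/-! ### States and effects -/

section States
variable {X : Type} [Fintype X] [DecidableEq X]

lemma exists_factor {M : Matrix X X ℂ} (hM : M.PosSemidef) :
    ∃ (r : ℕ) (B : Matrix (Fin r) X ℂ), M = Bᴴ * B := by
  obtain ⟨r, v, rfl⟩ := posSemidef_iff_eq_sum_vecMulVec.1 hM
  refine ⟨r, .of fun i x => star (v i x), ?_⟩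
  ext x y
  simp [Matrix.sum_apply, vecMulVec_apply, mul_apply]

/-- With N = B†B, cyclicity turns the trace into that of the positive operator BMB†. -/
lemma trace_mul_nonneg {M N : Matrix X X ℂ} (hM : M.PosSemidef) (hN : N.PosSemidef) :
    0 ≤ (M * N).trace := by
  obtain ⟨r, B, rfl⟩ := exists_factor hN
  rw [← Matrix.mul_assoc, trace_mul_comm, ← Matrix.mul_assoc]
  exact (hM.mul_mul_conjTranspose_same B).trace_nonneg

lemma norm_dotProduct_sq_le {Y : Type*} [Fintype Y] (u v : Y → ℂ) :
    ‖star u ⬝ᵥ v‖ ^ 2 ≤ (∑ i, ‖u i‖ ^ 2) * ∑ i, ‖v i‖ ^ 2 := by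
  refine le_trans ?_ (Finset.sum_mul_sq_le_sq_mul_sq _ (fun i => ‖u i‖) fun i => ‖v i‖)
  gcongr
  refine (norm_sum_le _ _).trans (le_of_eq (Finset.sum_congr rfl fun i _ => ?_))
  simp

lemma star_dotProduct_self {Y : Type*} [Fintype Y] (u : Y → ℂ) :
    star u ⬝ᵥ u = ((∑ i, ‖u i‖ ^ 2 : ℝ) : ℂ) := by
  push_cast
  exact Finset.sum_congr rfl fun i _ => by
    simp [Complex.conj_mul']

lemma quadratic_factor {Y : Type*} [Fintype Y] (B : Matrix Y X ℂ) (x y : X → ℂ) :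
    star x ⬝ᵥ ((Bᴴ * B) *ᵥ y) = star (B *ᵥ x) ⬝ᵥ (B *ᵥ y) := by
  rw [← mulVec_mulVec, dotProduct_mulVec, star_mulVec]

lemma trace_conjTranspose_mul_self {Y : Type*} [Fintype Y] (B : Matrix Y X ℂ) :
    (Bᴴ * B).trace = ((∑ i, ∑ j, ‖B i j‖ ^ 2 : ℝ) : ℂ) := by
  rw [Finset.sum_comm]
  push_cast
  exact Finset.sum_congr rfl fun i _ => by
    simp [mul_apply, Complex.conj_mul']

/-- A positive operator is at most its trace. -/
lemma trace_sub_posSemidef {M : Matrix X X ℂ} (hM : M.PosSemidef) :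
    (M.trace • 1 - M).PosSemidef := by
  have hre : star M.trace = M.trace := by
    rw [← trace_conjTranspose, hM.isHermitian.eq]
  refine .of_dotProduct_mulVec_nonneg ?_ fun x => ?_
  · rw [IsHermitian, conjTranspose_sub, conjTranspose_smul, conjTranspose_one, hre,
      hM.isHermitian.eq]
  · obtain ⟨r, B, rfl⟩ := exists_factor hM
    rw [sub_mulVec, dotProduct_sub, smul_mulVec, one_mulVec, dotProduct_smul, quadratic_factor,
      star_dotProduct_self, star_dotProduct_self, trace_conjTranspose_mul_self, smul_eq_mul,
      ← Complex.ofReal_mul, sub_nonneg, Complex.real_le_real, Finset.sum_mul]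
    -- Cauchy-Schwarz for each row of the factor `B`.
    refine Finset.sum_le_sum fun i _ => ?_
    have := norm_dotProduct_sq_le (star (B i)) x
    simp only [star_star, Pi.star_apply, norm_star] at this
    exact this

/-- A state is above its square. -/
lemma sub_sq_posSemidef {M : Matrix X X ℂ} (hM : M.PosSemidef) (h1 : M.trace = 1) :
    (M - M * M).PosSemidef := by
  obtain ⟨r, B, rfl⟩ := exists_factor hM
  -- With M = B†B one has M - M² = B†(1 - BB†)B, and BB† ≤ 1 because its trace is also 1.
  have h := trace_sub_posSemidef (posSemidef_self_mul_conjTranspose B)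
  rw [trace_mul_comm, h1, one_smul] at h
  convert h.conjTranspose_mul_mul_same B using 1
  simp only [Matrix.mul_sub, Matrix.sub_mul, Matrix.mul_one, Matrix.mul_assoc]

lemma trace_mul_vecMulVec (M : Matrix X X ℂ) (u : X → ℂ) :
    (M * vecMulVec u (star u)).trace = star u ⬝ᵥ (M *ᵥ u) := by
  rw [mul_vecMulVec, trace_vecMulVec, dotProduct_comm]

lemma norm_add_sq_le (a b : ℂ) : ‖a + b‖ ^ 2 ≤ 2 * ‖a‖ ^ 2 + 2 * ‖b‖ ^ 2 := by
  have := norm_add_le a b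
  nlinarith [sq_nonneg (‖a‖ - ‖b‖), norm_nonneg (a + b), norm_nonneg a, norm_nonneg b]

/-- If an effect almost accepts a pure state `u`, then it accepts another state with at least about
half of its overlap with `u`. -/
lemma overlap_le {E : Matrix X X ℂ} (hE : E.PosSemidef) (hE' : (1 - E).PosSemidef) {u : X → ℂ}
    (hu : star u ⬝ᵥ u = 1) {σ : Matrix X X ℂ} (hσ : σ.PosSemidef) (hσ1 : σ.trace = 1) :
    (σ * vecMulVec u (star u)).trace.re ≤
      2 * (E * σ).trace.re + 2 * (1 - (E * vecMulVec u (star u)).trace.re) := by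
  set c : ℝ := 1 - (E * vecMulVec u (star u)).trace.re with hc
  -- This is |u⟩⟨u| ≤ 2E + 2c. With E = G†G and 1 - E = H†H, split ⟨u, x⟩ = ⟨Gu, Gx⟩ + ⟨Hu, Hx⟩ and
  -- apply Cauchy-Schwarz to each term, using ‖Gu‖² ≤ 1 and ‖Hu‖² = c.
  have key : ((2 : ℂ) • E + ((2 * c : ℝ) : ℂ) • 1 - vecMulVec u (star u)).PosSemidef := by
    refine .of_dotProduct_mulVec_nonneg ?_ fun x => ?_
    · rw [IsHermitian, conjTranspose_sub, conjTranspose_add, conjTranspose_smul, conjTranspose_smul,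
        conjTranspose_one, hE.isHermitian.eq, conjTranspose_vecMulVec, star_star]
      simp [Complex.conj_ofReal, -Complex.ofReal_mul]
    · obtain ⟨r, G, hG⟩ := exists_factor hE
      obtain ⟨s, H, hH⟩ := exists_factor hE'
      have h1 : star u ⬝ᵥ x = star (G *ᵥ u) ⬝ᵥ (G *ᵥ x) + star (H *ᵥ u) ⬝ᵥ (H *ᵥ x) := by
        rw [← quadratic_factor, ← quadratic_factor, ← hG, ← hH, ← dotProduct_add, ← add_mulVec]
        simp
      have h2 : ∀ y : X → ℂ, (∑ i, ‖(G *ᵥ y) i‖ ^ 2) + ∑ i, ‖(H *ᵥ y) i‖ ^ 2 =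
          ∑ i, ‖y i‖ ^ 2 := by
        intro y
        rw [← Complex.ofReal_inj, Complex.ofReal_add, ← star_dotProduct_self,
          ← star_dotProduct_self, ← star_dotProduct_self, ← quadratic_factor, ← quadratic_factor,
          ← hG, ← hH, ← dotProduct_add, ← add_mulVec]
        simp
      have h3 : ∑ i, ‖u i‖ ^ 2 = 1 := by
        rw [← Complex.ofReal_inj, ← star_dotProduct_self, hu, Complex.ofReal_one]
      have h4 : c = ∑ i, ‖(H *ᵥ u) i‖ ^ 2 := by
        rw [hc, trace_mul_vecMulVec, hG, quadratic_factor, star_dotProduct_self, Complex.ofReal_re]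
        linarith [h2 u]
      have h5 := norm_add_sq_le (star (G *ᵥ u) ⬝ᵥ (G *ᵥ x)) (star (H *ᵥ u) ⬝ᵥ (H *ᵥ x))
      rw [← h1] at h5
      have h6 := norm_dotProduct_sq_le (G *ᵥ u) (G *ᵥ x)
      have h7 := norm_dotProduct_sq_le (H *ᵥ u) (H *ᵥ x)
      have h8 : star x ⬝ᵥ (vecMulVec u (star u) *ᵥ x) = ((‖star u ⬝ᵥ x‖ ^ 2 : ℝ) : ℂ) := by
        have : star x ⬝ᵥ u = star (star u ⬝ᵥ x) := by rw [star_dotProduct]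
        rw [vecMulVec_mulVec, dotProduct_smul, this]
        simp [Complex.conj_mul']
      rw [sub_mulVec, add_mulVec, dotProduct_sub, dotProduct_add, smul_mulVec, smul_mulVec,
        one_mulVec, dotProduct_smul, dotProduct_smul, h8, hG, quadratic_factor,
        star_dotProduct_self, star_dotProduct_self, sub_nonneg, smul_eq_mul, smul_eq_mul,
        ← Complex.ofReal_ofNat, ← Complex.ofReal_mul, ← Complex.ofReal_mul, ← Complex.ofReal_add,
        Complex.real_le_real]
      have n1 : 0 ≤ ∑ i, ‖(G *ᵥ x) i‖ ^ 2 := Finset.sum_nonneg fun _ _ => by positivity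
      have n2 : 0 ≤ ∑ i, ‖(H *ᵥ u) i‖ ^ 2 := Finset.sum_nonneg fun _ _ => by positivity
      have h9 : (∑ i, ‖(G *ᵥ u) i‖ ^ 2) * ∑ i, ‖(G *ᵥ x) i‖ ^ 2 ≤ ∑ i, ‖(G *ᵥ x) i‖ ^ 2 :=
        mul_le_of_le_one_left n1 (by linarith [h2 u])
      have h10 : (∑ i, ‖(H *ᵥ u) i‖ ^ 2) * ∑ i, ‖(H *ᵥ x) i‖ ^ 2 ≤ c * ∑ i, ‖x i‖ ^ 2 := by
        rw [h4]; gcongr; linarith [h2 x]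
      linarith
  have h := (Complex.le_def.1 (trace_mul_nonneg key hσ)).1
  rw [Matrix.sub_mul, Matrix.add_mul, trace_sub, trace_add, smul_mul, smul_mul, trace_smul,
    trace_smul, Matrix.one_mul, hσ1, trace_mul_comm (vecMulVec _ _)] at h
  simp at h
  linarith

end States

/-! ### Verification circuits as two-outcome measurements -/

section Circuit
variable {κ m : ℕ}

/-- The verdict of a verification circuit is a measurement. -/
lemma exists_effect (C : QCircuit (κ + m) 1) (k : Bits κ) :
    ∃ E : Op m, E.PosSemidef ∧ (1 - E).PosSemidef ∧ ∀ (ρ : Op m) (b : Bool),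
      C.run (tensor (ket k) ρ) (fun _ => b) (fun _ => b) =
        ((if b then E else 1 - E) * ρ).trace := by
  set A := C.iso * funMatrix fun p : Bits m => (Fin.append k p : Bits (κ + m)) with hA
  have hAA : Aᴴ * A = 1 := by
    rw [hA, conjTranspose_mul, Matrix.mul_assoc, ← Matrix.mul_assoc _ C.iso, C.iso_isometry,
      Matrix.one_mul, funMatrix_isometry (append_injective_right k)]
  -- The projection onto the output bit `b`; pulled back along the isometry `A`, it is the effect of
  -- that verdict.
  set D : Bool → Op (κ + m + C.anc) := fun b =>
    diagonal fun x => if x ∘ C.out = fun _ => b then 1 else 0 with hD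
  have hDpos : ∀ b, (D b).PosSemidef := fun b => .diagonal fun x => by
    dsimp only
    split_ifs <;> simp
  have hDsum : D true + D false = 1 := by
    rw [hD]
    simp only [diagonal_add]
    rw [← diagonal_one]
    congr 1
    funext x
    have h : ∀ b, (x ∘ C.out = fun _ => b) ↔ x (C.out 0) = b := fun b =>
      ⟨fun h => congrFun h 0, fun h => funext fun i => by rw [Subsingleton.elim i 0]; exact h⟩
    simp only [h]
    cases x (C.out 0) <;> simp
  have hE : ∀ b, Aᴴ * D b * A = if b then Aᴴ * D true * A else 1 - Aᴴ * D true * A := by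
    intro b
    cases b
    · rw [if_neg (by simp), eq_sub_iff_add_eq', ← Matrix.add_mul, ← Matrix.mul_add, hDsum,
        Matrix.mul_one, hAA]
    · simp
  refine ⟨Aᴴ * D true * A, (hDpos _).conjTranspose_mul_mul_same _, ?_, fun ρ b => ?_⟩
  · have := hE false
    rw [if_neg (by simp)] at this
    rw [← this]
    exact (hDpos _).conjTranspose_mul_mul_same _
  · rw [← hE, C.run_eq, ket_tensor, reduceTo_diag]
    have h1 : (Aᴴ * D b * A * ρ).trace = (D b * (A * ρ * Aᴴ)).trace := by
      rw [Matrix.mul_assoc, Matrix.mul_assoc, trace_mul_comm]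
      simp only [Matrix.mul_assoc]
    have h2 : C.iso * (funMatrix (fun p : Bits m => (Fin.append k p : Bits (κ + m))) * ρ *
        (funMatrix (fun p : Bits m => (Fin.append k p : Bits (κ + m))))ᴴ) * C.isoᴴ = A * ρ * Aᴴ := by
      rw [hA, conjTranspose_mul]
      simp only [Matrix.mul_assoc]
    rw [h1, h2, trace]
    refine Finset.sum_congr rfl fun x _ => ?_
    rw [diag_apply, hD, diagonal_mul]
    simp

end Circuit

/-! ### Products of states -/

section Copies
variable {l m : ℕ}

/-- A string of blocks is the family of its blocks. -/
def blockEquiv (l m : ℕ) : Bits (l * m) ≃ (Fin l → Bits m) where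
  toFun x := block x
  invFun b q := b (finProdFinEquiv.symm q).1 (finProdFinEquiv.symm q).2
  left_inv x := by
    funext q
    change x (finProdFinEquiv (finProdFinEquiv.symm q)) = x q
    rw [Equiv.apply_symm_apply]
  right_inv b := by
    funext j i
    change b (finProdFinEquiv.symm (finProdFinEquiv (j, i))).1
      (finProdFinEquiv.symm (finProdFinEquiv (j, i))).2 = b j i
    rw [Equiv.symm_apply_apply]

lemma sum_prod_block {R : Type*} [CommSemiring R] (f : Fin l → Bits m → R) :
    ∑ x : Bits (l * m), ∏ j, f j (block x j) = ∏ j, ∑ x, f j x := by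
  rw [Finset.prod_univ_sum, Fintype.piFinset_univ]
  exact (blockEquiv l m).sum_comp fun b => ∏ j, f j (b j)

lemma trace_copies (ρ : Op m) : (copies l ρ).trace = ρ.trace ^ l := by
  rw [trace]
  refine (sum_prod_block fun (_ : Fin l) x => ρ x x).trans ?_
  simp [trace]

lemma copies_vecMulVec_posSemidef (u : Bits m → ℂ) :
    (copies l (vecMulVec u (star u))).PosSemidef := by
  have : copies l (vecMulVec u (star u)) =
      vecMulVec (fun x => ∏ j, u (block x j)) (star fun x => ∏ j, u (block x j)) := by
    ext x y
    simp [copies, vecMulVec_apply, Finset.prod_mul_distrib]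
  rw [this]
  exact posSemidef_vecMulVec_self_star _

end Copies

/-- Few successes are unlikely if the expected number of successes is large. -/
lemma half_le_tail {l : ℕ} (w : Bool → ℝ) (hw : ∀ b, 0 ≤ w b) (hw1 : w true + w false = 1) (t : ℕ)
    (h : 2 * t + 2 ≤ l * w true) :
    1 / 2 ≤ ∑ v : Fin l → Bool with t + 1 ≤ (Finset.univ.filter fun j => v j = true).card,
      ∏ j, w (v j) := by
  have hprod : ∀ g : Bool → ℝ, ∑ v : Fin l → Bool, ∏ j, g (v j) = (g true + g false) ^ l := by
    intro g
    have := (Finset.prod_univ_sum (fun _ : Fin l => (Finset.univ : Finset Bool))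
      fun _ b => g b).symm
    rw [Fintype.piFinset_univ] at this
    simpa using this
  have htot := hprod w
  rw [hw1, one_pow, ← Finset.sum_filter_add_sum_filter_not Finset.univ
    fun v : Fin l → Bool => t + 1 ≤ (Finset.univ.filter fun j => v j = true).card] at htot
  -- An exponential moment bound: a `v` with at most `t` successes has weight 2^t · 2^(-successes) ≥
  -- 1, and the expectation of this weight factors over the registers.
  have hb : ∑ v : Fin l → Bool with ¬ t + 1 ≤ (Finset.univ.filter fun j => v j = true).card,
      ∏ j, w (v j) ≤ 2 ^ t * (w true / 2 + w false) ^ l := by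
    have h2 := hprod fun b => if b then w true / 2 else w false
    simp only [if_true, Bool.false_eq_true, if_false] at h2
    rw [← h2, Finset.mul_sum]
    refine (Finset.sum_le_sum fun v hv => ?_).trans
      (Finset.sum_le_sum_of_subset_of_nonneg (Finset.filter_subset _ _) fun v _ _ => ?_)
    · have h3 : (∏ j, if v j = true then w true / 2 else w false) =
          (1 / 2) ^ (Finset.univ.filter fun j => v j = true).card * ∏ j, w (v j) := by
        rw [← Finset.prod_const, Finset.prod_filter, ← Finset.prod_mul_distrib]
        refine Finset.prod_congr rfl fun j _ => ?_
        cases v j <;> simp; ring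
      rw [h3, ← mul_assoc]
      refine le_mul_of_one_le_left (Finset.prod_nonneg fun _ _ => hw _) ?_
      rw [Finset.mem_filter, not_le, Nat.lt_succ_iff] at hv
      rw [one_div, inv_pow, ← div_eq_mul_inv, one_le_div (by positivity)]
      exact pow_le_pow_right₀ (by norm_num) hv.2
    · refine mul_nonneg (by positivity) (Finset.prod_nonneg fun j _ => ?_)
      split_ifs
      · exact div_nonneg (hw _) (by norm_num)
      · exact hw _
  have hc : (2 : ℝ) ^ t * (w true / 2 + w false) ^ l ≤ 1 / 2 := by
    -- The left side is 1 - `w true` / 2. Its l-th power is thus at most e^(-(t+1)), which beats 2^t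
    -- by a factor of at least 2.
    have h1 : w true / 2 + w false ≤ Real.exp (-(w true / 2)) := by
      have := Real.add_one_le_exp (-(w true / 2))
      linarith
    have h2 : (w true / 2 + w false) ^ l ≤ Real.exp (-(t + 1)) := by
      refine (pow_le_pow_left₀ (by have := hw true; have := hw false; positivity) h1 l).trans ?_
      rw [← Real.exp_nat_mul]
      exact Real.exp_le_exp.2 (by linarith)
    have h3 : (2 : ℝ) ≤ Real.exp 1 := by have := Real.add_one_le_exp (1 : ℝ); linarith
    have h4 : Real.exp (-((t : ℝ) + 1)) = (Real.exp 1 ^ (t + 1))⁻¹ := by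
      rw [← Real.exp_nat_mul, ← Real.exp_neg]; push_cast; ring_nf
    have h5 : (2 : ℝ) ^ (t + 1) ≤ Real.exp 1 ^ (t + 1) := pow_le_pow_left₀ (by norm_num) h3 _
    calc (2 : ℝ) ^ t * (w true / 2 + w false) ^ l
        ≤ 2 ^ t * (Real.exp 1 ^ (t + 1))⁻¹ := by rw [← h4]; gcongr
      _ ≤ 2 ^ t * (2 ^ (t + 1))⁻¹ := by gcongr
      _ = 1 / 2 := by rw [pow_succ]; field_simp
  linarith

end QCrypto

namespace QCrypto

open Matrix
open scoped ComplexOrder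

/-! ### Quantum money with pure money states gives one-way state generators -/

section Verdict
variable {κ m : ℕ → ℕ}

/-- The verdict on each register is the trace against an effect, so the double sum over strings of
blocks factors register by register: on a product state the verdicts are independent, and mixtures
follow by linearity. -/
lemma verdictProb_sum (Ver : QAlgorithm (fun n => κ n + m n) (fun _ => 1)) (n : ℕ)
    (k : Bits (κ n)) {l : ℕ} {ι : Type} [Fintype ι] (c : ι → ℝ) (σ : ι → Op (m n))
    (hσ : ∀ i, (σ i).PosSemidef) (v : Fin l → Bool) :
    verdictProb Ver n k (∑ i, (c i : ℂ) • copies l (σ i)) v =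
      ∑ i, c i * ∏ j, (Ver n).prob (tensor (ket k) (σ i)) fun _ => v j := by
  obtain ⟨E, -, -, hE⟩ := exists_effect (Ver n) k
  have h1 : ∀ i, ∑ x : Bits (l * m n), ∑ y : Bits (l * m n), copies l (σ i) x y *
      ∏ j, (if v j then E else 1 - E) (block y j) (block x j) =
      ((∏ j, (Ver n).prob (tensor (ket k) (σ i)) fun _ => v j : ℝ) : ℂ) := by
    intro i
    simp only [copies, of_apply, ← Finset.prod_mul_distrib]
    have h2 : ∀ x : Bits (l * m n), ∑ y : Bits (l * m n), ∏ j, (σ i (block x j) (block y j) *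
        (if v j then E else 1 - E) (block y j) (block x j)) =
        ∏ j, ∑ y, (σ i (block x j) y * (if v j then E else 1 - E) y (block x j)) := fun x =>
      sum_prod_block fun j y => σ i (block x j) y * (if v j then E else 1 - E) y (block x j)
    simp only [h2]
    rw [sum_prod_block fun j x => ∑ y, (σ i x y * (if v j then E else 1 - E) y x),
      Complex.ofReal_prod]
    refine Finset.prod_congr rfl fun j _ => ?_
    rw [← QCircuit.run_diag _ (tensor_posSemidef k (hσ i)), hE, trace_mul_comm]
    simp only [trace, diag_apply, mul_apply]
  have h3 : ∀ (x y : Bits (m n)) (b : Bool), (Ver n).run (tensor (ket k) (single x y 1))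
      (fun _ => b) (fun _ => b) = (if b then E else 1 - E) y x := by
    intro x y b
    rw [hE, trace_mul_single]
    simp
  simp only [verdictProb, h3]
  have h4 : ∑ x : Bits (l * m n), ∑ y : Bits (l * m n), (∑ i, (c i : ℂ) • copies l (σ i)) x y *
      ∏ j, (if v j then E else 1 - E) (block y j) (block x j) =
      ((∑ i, c i * ∏ j, (Ver n).prob (tensor (ket k) (σ i)) fun _ => v j : ℝ) : ℂ) := by
    rw [Complex.ofReal_sum]
    simp only [Complex.ofReal_mul, ← h1, Matrix.sum_apply, Matrix.smul_apply, smul_eq_mul,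
      Finset.sum_mul, Finset.mul_sum]
    rw [Finset.sum_comm_cycle]
    simp only [mul_assoc]
  rw [h4, Complex.ofReal_re]

lemma countProb_sum (Ver : QAlgorithm (fun n => κ n + m n) (fun _ => 1)) (n : ℕ)
    (k : Bits (κ n)) {l : ℕ} {ι : Type} [Fintype ι] (c : ι → ℝ) (σ : ι → Op (m n))
    (hσ : ∀ i, (σ i).PosSemidef) (s : ℕ) :
    countProb Ver n k (∑ i, (c i : ℂ) • copies l (σ i)) s =
      ∑ i, c i * ∑ v : Fin l → Bool with s ≤ (Finset.univ.filter fun j => v j = true).card,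
        ∏ j, (Ver n).prob (tensor (ket k) (σ i)) fun _ => v j := by
  simp only [countProb, verdictProb_sum Ver n k c σ hσ, Finset.mul_sum]
  exact Finset.sum_comm

end Verdict

section Circuit
variable {κ m : ℕ}

/-- Normalisation is not part of `HasPureMoney`; it follows because circuits preserve the trace. -/
lemma dotProduct_eq_one_of_run (M : QCircuit κ m) {k : Bits κ} {u : Bits m → ℂ}
    (hu : M.run (ket k) = vecMulVec u (star u)) : star u ⬝ᵥ u = 1 := by
  have h := M.trace_run (ket k)
  rwa [hu, trace_ket, trace_vecMulVec, dotProduct_comm] at h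

/-- On a key with a pure state, `projCircuit` is the projection onto that state. -/
lemma prob_projCircuit_of_pure (M : QCircuit κ m) {k : Bits κ} {u : Bits m → ℂ}
    (hu : M.run (ket k) = vecMulVec u (star u)) (ρ : Op m) :
    (projCircuit M).prob (tensor (ket k) ρ) (fun _ => true) = (star u ⬝ᵥ (ρ *ᵥ u)).re := by
  have h1 := dotProduct_eq_one_of_run M hu
  rw [prob_projCircuit, hu, conjTranspose_vecMulVec, star_star, trace_mul_comm, ← Matrix.mul_assoc,
    vecMulVec_mul_vecMulVec, h1, one_smul, trace_mul_comm, trace_mul_vecMulVec]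

/-- A key that `projCircuit` accepts on a state gives copies of which many are accepted. -/
lemma prob_projCircuit_le (M : QCircuit κ m) (V : QCircuit (κ + m) 1) {k : Bits κ}
    {u : Bits m → ℂ} (hu : M.run (ket k) = vecMulVec u (star u)) (k' : Bits κ) (t : ℕ) {l : ℕ}
    (hl : 0 < l) :
    (projCircuit M).prob (tensor (ket k') (M.run (ket k))) (fun _ => true) ≤
      2 * ((2 * t + 2) / l) +
      4 * (∑ v : Fin l → Bool with t + 1 ≤ (Finset.univ.filter fun j => v j = true).card,
        ∏ j, V.prob (tensor (ket k) (M.run (ket k'))) fun _ => v j) +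
      2 * (1 - V.prob (tensor (ket k) (M.run (ket k))) fun _ => true) := by
  obtain ⟨E, hE, hE', hEr⟩ := exists_effect V k
  set σ := M.run (ket k') with hσ
  have hσ0 : σ.PosSemidef := M.run_posSemidef (ket_posSemidef k')
  have hσ1 : σ.trace = 1 := by rw [hσ, M.trace_run, trace_ket]
  -- Nothing is known about the purity of `σ`, so the acceptance probability is only ⟨u|σ²|u⟩, which
  -- σ² ≤ σ bounds by the overlap.
  have h1 : (projCircuit M).prob (tensor (ket k') (M.run (ket k))) (fun _ => true) ≤
      (σ * vecMulVec u (star u)).trace.re := by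
    rw [prob_projCircuit, ← hσ, hσ0.isHermitian.eq, hu, trace_mul_comm, ← Matrix.mul_assoc]
    have := (Complex.le_def.1 (trace_mul_nonneg (sub_sq_posSemidef hσ0 hσ1)
      (posSemidef_vecMulVec_self_star u))).1
    rw [Matrix.sub_mul, trace_sub, Complex.sub_re, Complex.zero_re] at this
    linarith
  have h2 := overlap_le hE hE' (dotProduct_eq_one_of_run M hu) hσ0 hσ1
  have hprob : ∀ ρ : Op m, V.prob (tensor (ket k) ρ) (fun _ => true) = (E * ρ).trace.re := fun ρ =>
    congrArg Complex.re (hEr ρ true)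
  set w : Bool → ℝ := fun b => V.prob (tensor (ket k) σ) fun _ => b with hw
  have hw0 : ∀ b, 0 ≤ w b := fun b => V.prob_nonneg (tensor_posSemidef k hσ0) _
  have hw1 : w true + w false = 1 := by
    have := V.sum_prob (tensor (ket k) σ)
    rw [trace_tensor, hσ1, ← (Equiv.funUnique (Fin 1) Bool).symm.sum_comp, Fintype.sum_bool] at this
    exact this
  have htail : 0 ≤ ∑ v : Fin l → Bool with t + 1 ≤ (Finset.univ.filter fun j => v j = true).card,
      ∏ j, w (v j) := Finset.sum_nonneg fun v _ => Finset.prod_nonneg fun j _ => hw0 _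
  have h3 : w true ≤ (2 * t + 2) / l +
      2 * ∑ v : Fin l → Bool with t + 1 ≤ (Finset.univ.filter fun j => v j = true).card,
        ∏ j, w (v j) := by
    have hl' : (0 : ℝ) < l := by exact_mod_cast hl
    -- Above the threshold the expected number of accepted copies is at least 2t + 2, so twice the
    -- tail is at least 1 and bounds any probability.
    rcases le_total (w true) ((2 * t + 2) / l) with h | h
    · linarith
    · have := half_le_tail (l := l) w hw0 hw1 t (by
        rw [div_le_iff₀ hl'] at h; linarith)
      have h4 : 0 ≤ ((2 * t + 2) / l : ℝ) := by positivity
      have := hw0 false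
      linarith
  rw [hprob, hu]
  have h5 : w true = (E * σ).trace.re := hprob σ
  rw [← h5] at h2
  rw [hu] at h1
  simp only [hw] at h2 h3
  linarith

end Circuit

/-! ### Uniformity and the reduction from forging -/

section Polynomial
variable {κ m : ℕ → ℕ}

lemma IsQPT.proj {M : QAlgorithm κ m} (hM : IsQPT M) :
    IsQPT (a := fun n => κ n + m n) (b := fun _ => 1) fun n => projCircuit (M n) := by
  rw [isQPT_iff] at hM ⊢
  simp only [raw_projCircuit]
  have ho : PolyTime fun n => List.ofFn fun i => ((M n).out i : ℕ) := hM.snd.snd.snd.fst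
  have hκ : PolyTime κ := hM.fst
  -- The number of state qubits is read off as the length of the list of output wires.
  have hm : PolyTime m := by simpa using ho.length
  exact .projRaw hκ (hκ.add hM.snd.fst) hm hM.snd.snd.fst ho

lemma IsQPT.clone {a : ℕ → ℕ} {A : QAlgorithm a κ} {M : QAlgorithm κ m} (hA : IsQPT A)
    (hM : IsQPT M) (l : Polynomial ℕ) :
    IsQPT (a := a) (b := fun n => l.eval n * m n) fun n => cloneCircuit (l.eval n) (A n) (M n) := by
  rw [isQPT_iff] at hA hM ⊢
  simp only [raw_cloneCircuit]
  have hκ : PolyTime κ := hM.fst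
  exact .cloneRaw (.eval l) hA.fst hκ hA.snd.fst (hκ.add hM.snd.fst) hA.snd.snd.fst
    hA.snd.snd.snd.fst hM.snd.snd.fst hM.snd.snd.snd.fst

lemma keyProb_nonneg (KeyGen : QAlgorithm (fun _ => 0) κ) (n : ℕ) (k : Bits (κ n)) :
    0 ≤ keyProb KeyGen n k :=
  (KeyGen n).prob_nonneg (ket_posSemidef _) _

lemma sum_keyProb (KeyGen : QAlgorithm (fun _ => 0) κ) (n : ℕ) : ∑ k, keyProb KeyGen n k = 1 := by
  simp only [keyProb, QCircuit.sum_prob, trace_ket, Complex.one_re]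

/-- Purity is only assumed for keys of positive probability, so bounds are available only for those;
the other keys have weight 0. -/
lemma sum_keyProb_mul_le (KeyGen : QAlgorithm (fun _ => 0) κ) (n : ℕ) {f g : Bits (κ n) → ℝ}
    (h : ∀ k, 0 < keyProb KeyGen n k → f k ≤ g k) :
    ∑ k, keyProb KeyGen n k * f k ≤ ∑ k, keyProb KeyGen n k * g k := by
  refine Finset.sum_le_sum fun k _ => ?_
  rcases (keyProb_nonneg KeyGen n k).eq_or_lt with h0 | h0
  · rw [← h0]; simp
  · exact mul_le_mul_of_nonneg_left (h k h0) h0.le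

variable {KeyGen : QAlgorithm (fun _ => 0) κ} {Mint : QAlgorithm κ m}
  {Ver : QAlgorithm (fun n => κ n + m n) (fun _ => 1)} {money : ∀ n, Bits (κ n) → Bits (m n) → ℂ}

lemma copies_posSemidef (hpure : HasPureMoney KeyGen Mint money) {n t : ℕ} {k : Bits (κ n)}
    (hk : 0 < keyProb KeyGen n k) : (copies t (stateOf Mint n k)).PosSemidef := by
  rw [hpure n k hk]
  exact copies_vecMulVec_posSemidef _

/-- The probability that an adversary finds an accepted key is bounded by the probability that
`cloneCircuit` forges banknotes. -/
lemma owsg_advantage_le (hpure : HasPureMoney KeyGen Mint money) (n t l : ℕ) (hl : 0 < l)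
    (A : QCircuit (t * m n) (κ n)) :
    ∑ k, keyProb KeyGen n k * ∑ k', A.prob (copies t (stateOf Mint n k)) k' *
        (projCircuit (Mint n)).prob (tensor (ket k') (stateOf Mint n k)) (fun _ => true) ≤
      2 * ((2 * t + 2) / l) +
      4 * (∑ k, keyProb KeyGen n k * countProb Ver n k
        ((cloneCircuit l A (Mint n)).run (copies t (stateOf Mint n k))) (t + 1)) +
      2 * (1 - ∑ k, keyProb KeyGen n k * acceptProb Ver n k (stateOf Mint n k)) := by
  -- All terms are written as averages over the key, so that it suffices to compare them for each
  -- fixed key.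
  have hsum : 2 * ((2 * t + 2) / l) +
      4 * (∑ k, keyProb KeyGen n k * countProb Ver n k
        ((cloneCircuit l A (Mint n)).run (copies t (stateOf Mint n k))) (t + 1)) +
      2 * (1 - ∑ k, keyProb KeyGen n k * acceptProb Ver n k (stateOf Mint n k)) =
      ∑ k, keyProb KeyGen n k * (2 * ((2 * t + 2) / l) + 4 * countProb Ver n k
        ((cloneCircuit l A (Mint n)).run (copies t (stateOf Mint n k))) (t + 1) +
        2 * (1 - acceptProb Ver n k (stateOf Mint n k))) := by
    simp only [mul_add, mul_sub, Finset.sum_add_distrib, Finset.sum_sub_distrib, ← Finset.sum_mul,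
      Finset.mul_sum, sum_keyProb, mul_left_comm (keyProb KeyGen n _), one_mul, mul_one]
    simp only [← Finset.mul_sum, ← Finset.sum_mul, sum_keyProb, one_mul]
  rw [hsum]
  refine sum_keyProb_mul_le KeyGen n fun k hk => ?_
  have hρ := copies_posSemidef (t := t) hpure hk
  have hu := hpure n k hk
  set ρ := copies t (stateOf Mint n k) with hρ'
  have hρ1 : ρ.trace = 1 := by
    rw [hρ', trace_copies, stateOf, QCircuit.trace_run, trace_ket, one_pow]
  have hA1 : ∑ k', A.prob ρ k' = 1 := by rw [A.sum_prob, hρ1, Complex.one_re]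
  have hcount : countProb Ver n k ((cloneCircuit l A (Mint n)).run ρ) (t + 1) =
      ∑ k', A.prob ρ k' *
        ∑ v : Fin l → Bool with t + 1 ≤ (Finset.univ.filter fun j => v j = true).card,
          ∏ j, (Ver n).prob (tensor (ket k) ((Mint n).run (ket k'))) fun _ => v j := by
    rw [run_cloneCircuit]
    simp only [A.run_diag hρ]
    exact countProb_sum Ver n k _ _ (fun k' => (Mint n).run_posSemidef (ket_posSemidef k')) _
  rw [hcount]
  -- In the same way, constants become averages over the key found by the adversary.
  have hconst : ∀ c : ℝ, c = ∑ k', A.prob ρ k' * c := fun c => by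
    rw [← Finset.sum_mul, hA1, one_mul]
  rw [hconst (2 * ((2 * t + 2) / l)), hconst (2 * (1 - acceptProb Ver n k (stateOf Mint n k))),
    Finset.mul_sum, ← Finset.sum_add_distrib, ← Finset.sum_add_distrib]
  refine Finset.sum_le_sum fun k' _ => ?_
  have := mul_le_mul_of_nonneg_left
    (prob_projCircuit_le (Mint n) (Ver n) hu k' t hl) (A.prob_nonneg hρ k')
  refine this.trans (le_of_eq ?_)
  rw [acceptProb, stateOf]
  ring

end Polynomial

end QCrypto

open QCrypto in
theorem mainTheorem5 {κ m : ℕ → ℕ}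
    (KeyGen : QCrypto.QAlgorithm (fun _ => 0) κ)
    (Mint : QCrypto.QAlgorithm κ m)
    (Ver : QCrypto.QAlgorithm (fun n => κ n + m n) (fun _ => 1))
    (hQM : QCrypto.IsPrivateKeyQuantumMoney KeyGen Mint Ver)
    (money : ∀ n, QCrypto.Bits (κ n) → QCrypto.Bits (m n) → ℂ)
    (hpure : QCrypto.HasPureMoney KeyGen Mint money) :
    ∃ Ver' : QCrypto.QAlgorithm (fun n => κ n + m n) (fun _ => 1),
      QCrypto.IsOWSG KeyGen Mint Ver' ∧
      ∀ n (k' : QCrypto.Bits (κ n)), 0 < QCrypto.keyProb KeyGen n k' →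
        ∀ ρ : QCrypto.Op (m n),
          QCrypto.acceptProb Ver' n k' ρ
            = (star (money n k') ⬝ᵥ Matrix.mulVec ρ (money n k')).re := by
  have hproj : ∀ n (k' : Bits (κ n)), 0 < keyProb KeyGen n k' → ∀ ρ : Op (m n),
      acceptProb (fun n => projCircuit (Mint n)) n k' ρ =
        (star (money n k') ⬝ᵥ Matrix.mulVec ρ (money n k')).re := fun n k' hk ρ =>
    prob_projCircuit_of_pure (Mint n) (hpure n k' hk) ρ
  refine ⟨fun n => projCircuit (Mint n), ⟨hQM.keyGen_qpt, hQM.mint_qpt, hQM.mint_qpt.proj, ?_, ?_⟩,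
    hproj⟩
  -- Correctness is perfect: every possible key projects onto its own banknote.
  · have h : ∀ n, ∑ k, keyProb KeyGen n k *
        acceptProb (fun n => projCircuit (Mint n)) n k (stateOf Mint n k) = 1 := by
      intro n
      rw [← sum_keyProb KeyGen n]
      refine Finset.sum_congr rfl fun k _ => ?_
      rcases (keyProb_nonneg KeyGen n k).eq_or_lt with h0 | h0
      · rw [← h0, zero_mul]
      · have hu := dotProduct_eq_one_of_run (Mint n) (hpure n k h0)
        rw [hproj n k h0, hpure n k h0, Matrix.vecMulVec_mulVec, hu]
        simp [hu]
    simp only [h, sub_self]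
    exact Asymptotics.superpolynomialDecay_zero _ _
  · intro t A hA c
    -- Chosen so that n^c times the error term 4(t + 1)/l is 4/n; the forger depends on the exponent
    -- `c` under test.
    set l : Polynomial ℕ := (t + 1) * .X ^ (c + 1) with hl
    have hD := hQM.secure t l _ (hA.clone hQM.mint_qpt l) c
    have hε := hQM.correct c
    have h4 := tendsto_const_div_atTop_nhds_zero_nat (𝕜 := ℝ) 4
    have hlim := (h4.add (hD.const_mul 4)).add (hε.const_mul 2)
    simp only [mul_zero, add_zero] at hlim
    refine tendsto_of_tendsto_of_tendsto_of_le_of_le' tendsto_const_nhds hlim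
      (Filter.Eventually.of_forall fun n => ?_) ?_
    · refine mul_nonneg (by positivity) (Finset.sum_nonneg fun k _ => ?_)
      -- Positivity of the adversary's input comes from purity, hence only for keys of positive
      -- probability.
      rcases (keyProb_nonneg KeyGen n k).eq_or_lt with h0 | h0
      · rw [← h0, zero_mul]
      · refine mul_nonneg h0.le (Finset.sum_nonneg fun k' _ => mul_nonneg
          ((A n).prob_nonneg (copies_posSemidef hpure h0) _) (QCircuit.prob_nonneg _ ?_ _))
        exact tensor_posSemidef k' ((Mint n).run_posSemidef (ket_posSemidef k))
    · filter_upwards [Filter.eventually_gt_atTop 0] with n hn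
      have hln : l.eval n = (t.eval n + 1) * n ^ (c + 1) := by simp [hl]
      have hlpos : 0 < l.eval n := by rw [hln]; positivity
      have hb := mul_le_mul_of_nonneg_left
        (owsg_advantage_le (Ver := Ver) hpure n (t.eval n) (l.eval n) hlpos (A n))
        (pow_nonneg (Nat.cast_nonneg (α := ℝ) n) c)
      refine hb.trans (le_of_eq ?_)
      have hfrac : (n : ℝ) ^ c * (2 * ((2 * (t.eval n : ℕ) + 2) / (l.eval n : ℕ))) = 4 / n := by
        have hn' : (n : ℝ) ≠ 0 := by exact_mod_cast hn.ne'
        have ht' : ((t.eval n : ℕ) : ℝ) + 1 ≠ 0 := by positivity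
        rw [hln]
        push_cast
        field_simp
        ring
      rw [mul_add, mul_add, hfrac]
      ring
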